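/- **Setting.** Let $(M,\tau)$ be a von Neumann algebra with a faithful normal tracial state, acting on its GNS space $H=L^2(M,\tau)$ with canonical trace vector $\Omega$, so $\tau(x)=\langle\Omega,x\Omega\rangle$; let $J$ be the modular conjugation, $J(x\Omega)=x^*\Omega$, and let $M$ act on $H$ from the right by $\xi\cdot a=Ja^*J\xi$ and diagonally on $H^k$. Let $N\subseteq\mathcal A\subseteq M$, where $N$ is a von Neumann subalgebra and $\mathcal A$ is a strongly dense $*$-subalgebra of $M$, and let $E\colon M\to N$ be the $\tau$-preserving conditional expectation. **Dimensions and traces.** Let $R$ be $N$ or $M$. If a Hilbert space $F$ with a right $R$-action is isometrically and $R$-equivariantly isomorphic to $pL^2(R)^m$ for a projection $p\in\mathbb M_m(R)$ (a finitely generated normal module), then an $R$-equivariant bounded operator $S$ on $F$ corresponds to a matrix $(S_{ij})\in p\,\mathbb M_m(R)\,p$, and one sets $\mathrm{Tr}_R(S)=\sum_i\tau(S_{ii})$ and $\dim_R F=\mathrm{Tr}_R(\mathrm{id}_F)=\sum_i\tau(p_{ii})$; these do not depend on the choices. For an arbitrary algebraic right $R$-module $X$, $\dim_R X\in[0,\infty]$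 is the supremum of $\sum_i\tau(p_{ii})$ over all submodules $Q\subseteq X$ and projections $p\in\mathbb M_m(R)$ with $Q\cong pR^m$. **Relative dimension.** A right $N$-submodule $\mathcal F\subseteq M$ is *complete* if it is complete in the norm $\|E(x^*x)\|^{1/2}$. For a complete, non-zero, finitely generated projective $\mathcal F$ with closure $F$ in $H$, put $$\varphi_{\mathcal F}(x)=\frac{\mathrm{Tr}_N(P_FxP_F|_F)}{\dim_N\mathcal F}\quad(x\in M),\qquad \dim_{\mathcal F}\mathcal E=\frac{\mathrm{Tr}_N(P_{F^k}P_{\overline{\mathcal E}}P_{F^k}|_{F^k})}{\dim_N\mathcal F}$$ for an $N$-submodule $\mathcal E\subseteq H^k$, where $P_L$ is the orthogonal projection onto a closed subspace $L$. **Strong Følner property.** $\mathcal A$ has the strong Følner property relative to $N$ if for every finite set $T_1,\dots,T_r\in\mathcal A$ and every $\varepsilon>0$ there is a complete, non-zero, finitely generated projective right $N$-submodule $\mathcal F\subseteq\mathcal A$ with $$\frac{\dim_N(T_i^{-1}(\mathcal F)\cap\mathcal F)}{\dim_N\mathcal F}>1-\varepsilon\ \text{ for all } i,\qquad \|\varphi_{\mathcal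 F}-\tau\|_{M_*}<\varepsilon,$$ where $T_i^{-1}(\mathcal F)$ is the preimage under left multiplication by $T_i$. A *strong Følner sequence* for $T_1,\dots,T_r$ is a sequence of complete, non-zero, finitely generated projective right $N$-submodules $\mathcal P_n\subseteq\mathcal A$ with $N$-submodules $\mathcal S_n\subseteq\mathcal P_n$ such that $T_i\mathcal S_n\subseteq\mathcal P_n$ for all $i,n$, $\dim_N\mathcal S_n/\dim_N\mathcal P_n\to1$, and $\|\varphi_{\mathcal P_n}-\tau\|_{M_*}\to0$. **Proposition.** Assume that $\mathcal A$ has the strong Følner property relative to $N$, let $T=(T_{ij})\in\mathbb M_k(\mathcal A)$, and let $(\mathcal P_n,\mathcal S_n)$ be a strong Følner sequence for the set of matrix entries of $T$. Then $$\dim_M\ker(T)=\lim_{n\to\infty}\dim_{\mathcal P_n}\ker\bigl(T|_{\mathcal S_n^k}\bigr),$$ where $T$ acts on $H^k$ by matrix multiplication, $\ker(T)\subseteq H^k$, and $\ker(T|_{\mathcal S_n^k})\subseteq\mathcal A^k$ is regarded as a subspace of $H^k$ via $x\mapsto x\Omega$ in each coordinate. -/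

import Mathlib

open Filter Topology
open scoped ENNReal MulOpposite

noncomputable section

namespace FolnerDim

section Setup

variable {H : Type*} [NormedAddCommGroup H] [InnerProductSpace ℂ H] [CompleteSpace H]

/-- A tracial von Neumann algebra `(M, τ)` acting on its GNS space `H = L²(M, τ)`:
a von Neumann algebra `M` on `H` with a cyclic unit vector `Ω` (the class of `1`) whose vector
functional `τ x = ⟨Ω, x Ω⟩` is a trace on `M`.  Such a `τ` is automatically a faithful normal
tracial state, and up to unitary equivalence `(H, M, Ω)` is the GNS triple of `(M, τ)`; conversely
the GNS triple of every faithful normal tracial state is of this form. -/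
structure TracialAlgebra (H : Type*) [NormedAddCommGroup H] [InnerProductSpace ℂ H]
    [CompleteSpace H] where
  /-- the von Neumann algebra -/
  M : VonNeumannAlgebra H
  /-- the trace vector -/
  Ω : H
  norm_Ω : ‖Ω‖ = 1
  cyclic : Dense {ξ : H | ∃ x ∈ M, x Ω = ξ}
  tracial : ∀ x ∈ M, ∀ y ∈ M, inner ℂ Ω ((x * y) Ω) = inner ℂ Ω ((y * x) Ω)

namespace TracialAlgebra

variable (𝔐 : TracialAlgebra H)

/-- The trace `τ x = ⟨Ω, x Ω⟩`. -/
def τ (x : H →L[ℂ] H) : ℂ := inner ℂ 𝔐.Ω (x 𝔐.Ω)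

/-- The embedding `Λ x = x Ω` of operators into `H = L²(M, τ)`. -/
def Λ : (H →L[ℂ] H) →ₗ[ℂ] H := (ContinuousLinearMap.apply ℂ H 𝔐.Ω).toLinearMap

/-- The restriction of `Λ` to `M`. -/
def ΛM : 𝔐.M.toStarSubalgebra →ₗ[ℂ] H :=
  𝔐.Λ ∘ₗ 𝔐.M.toStarSubalgebra.toSubalgebra.toSubmodule.subtype

theorem denseRange_ΛM : DenseRange 𝔐.ΛM := by
  refine 𝔐.cyclic.mono ?_
  rintro ξ ⟨x, hx, rfl⟩
  exact ⟨⟨x, hx⟩, rfl⟩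

theorem norm_ΛM_star (x : 𝔐.M.toStarSubalgebra) : ‖𝔐.ΛM (star x)‖ = ‖𝔐.ΛM x‖ := by
  have key : ∀ y : H →L[ℂ] H, inner ℂ (y 𝔐.Ω) (y 𝔐.Ω) = inner ℂ 𝔐.Ω ((star y * y) 𝔐.Ω) := by
    intro y
    rw [ContinuousLinearMap.star_eq_adjoint, mul_apply_eq_comp,
      ContinuousLinearMap.adjoint_inner_right]
  have hx : (x : H →L[ℂ] H) ∈ 𝔐.M := x.2
  have h1 : inner ℂ ((star (x : H →L[ℂ] H)) 𝔐.Ω) ((star (x : H →L[ℂ] H)) 𝔐.Ω)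
      = inner ℂ ((x : H →L[ℂ] H) 𝔐.Ω) ((x : H →L[ℂ] H) 𝔐.Ω) := by
    rw [key, key, star_star]
    exact 𝔐.tracial _ hx _ (star_mem hx)
  change ‖(star (x : H →L[ℂ] H)) 𝔐.Ω‖ = ‖(x : H →L[ℂ] H) 𝔐.Ω‖
  rw [@norm_eq_sqrt_re_inner ℂ, @norm_eq_sqrt_re_inner ℂ _ _ _ _ ((x : H →L[ℂ] H) 𝔐.Ω), h1]

/-- The modular conjugation `J`: the conjugate-linear isometry of `H` with `J (x Ω) = x* Ω` for
`x ∈ M`. -/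
def J : H ≃ₗᵢ⋆[ℂ] H :=
  (starLinearEquiv ℂ (A := 𝔐.M.toStarSubalgebra)).extendOfIsometry 𝔐.ΛM 𝔐.ΛM
    𝔐.denseRange_ΛM 𝔐.denseRange_ΛM 𝔐.norm_ΛM_star

theorem J_apply (x : H →L[ℂ] H) (hx : x ∈ 𝔐.M) : 𝔐.J (x 𝔐.Ω) = (star x) 𝔐.Ω :=
  LinearEquiv.extendOfIsometry_eq (starLinearEquiv ℂ (A := 𝔐.M.toStarSubalgebra)) 𝔐.ΛM 𝔐.ΛM
    𝔐.denseRange_ΛM 𝔐.denseRange_ΛM 𝔐.norm_ΛM_star ⟨x, hx⟩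

/-- The right action `ξ · a = J a* J ξ` on `H`. -/
def ract (a : H →L[ℂ] H) (ξ : H) : H := 𝔐.J ((star a) (𝔐.J ξ))

/-- The right action extends right multiplication in `M`. -/
theorem ract_apply (a x : H →L[ℂ] H) (ha : a ∈ 𝔐.M) (hx : x ∈ 𝔐.M) :
    𝔐.ract a (x 𝔐.Ω) = (x * a) 𝔐.Ω := by
  have h : star a * star x ∈ 𝔐.M := mul_mem (star_mem ha) (star_mem hx)
  have := 𝔐.J_apply _ h
  rw [ract, 𝔐.J_apply x hx]
  simpa using this

end TracialAlgebra

/-- The Hilbert space direct sum `H^k`. -/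
abbrev Amp (H : Type*) [NormedAddCommGroup H] (k : ℕ) : Type _ :=
  PiLp 2 (fun _ : Fin k => H)

/-- The amplification `L^k ⊆ H^k` of a subspace `L ⊆ H`. -/
def ampSubspace (L : Submodule ℂ H) (k : ℕ) : Submodule ℂ (Amp H k) where
  carrier := {ξ | ∀ i, ξ i ∈ L}
  add_mem' hξ hη i := L.add_mem (hξ i) (hη i)
  zero_mem' _ := L.zero_mem
  smul_mem' c _ hξ i := L.smul_mem c (hξ i)

theorem isClosed_ampSubspace (L : Submodule ℂ H) (hL : IsClosed (L : Set H)) (k : ℕ) :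
    IsClosed (ampSubspace L k : Set (Amp H k)) := by
  have : (ampSubspace L k : Set (Amp H k)) =
      ⋂ i : Fin k, (fun ξ : Amp H k => ξ i) ⁻¹' (L : Set H) := by
    ext ξ
    rw [Set.mem_iInter]
    rfl
  rw [this]
  exact isClosed_iInter fun i => hL.preimage (by fun_prop)

/-- The operator on `H^k` given by a `k × k` matrix of operators on `H`:
`(T ξ) i = ∑ j, T i j (ξ j)`. -/
def matOp {k : ℕ} (T : Matrix (Fin k) (Fin k) (H →L[ℂ] H)) : Amp H k →L[ℂ] Amp H k :=
  (PiLp.continuousLinearEquiv 2 ℂ (fun _ : Fin k => H)).symm.toContinuousLinearMap ∘L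
    ContinuousLinearMap.pi fun i => ∑ j, T i j ∘L PiLp.proj 2 (fun _ : Fin k => H) j

end Setup

section Modules

variable {B : Type*} [Ring B] [StarRing B] [Algebra ℂ B] [StarModule ℂ B]

/-- `B` as a right module over a `*`-subalgebra `R ⊆ B`, i.e. as a module over the opposite ring;
the action is right multiplication in `B`. -/
instance rightModule (R : StarSubalgebra ℂ B) : Module (↥R)ᵐᵒᵖ B :=
  Module.compHom B (RingHom.op (R.subtype : ↥R →+* B))

theorem op_smul_eq (R : StarSubalgebra ℂ B) (a : R) (x : B) :
    MulOpposite.op a • x = x * (a : B) := rfl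

/-- A right `R`-submodule of `B`, seen as a complex subspace (note `ℂ 1 ⊆ R`). -/
def toComplex {R : StarSubalgebra ℂ B} (P : Submodule (↥R)ᵐᵒᵖ B) : Submodule ℂ B where
  carrier := P
  add_mem' := P.add_mem
  zero_mem' := P.zero_mem
  smul_mem' c x hx := by
    have h := P.smul_mem (MulOpposite.op (algebraMap ℂ R c)) hx
    rw [op_smul_eq] at h
    have e : x * ((algebraMap ℂ R c : R) : B) = c • x := by
      rw [Algebra.smul_def]
      exact (Algebra.commutes c x).symm
    rwa [e] at h

/-- The preimage `t⁻¹(P)` of a right submodule `P` under left multiplication by `t`. -/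
def leftPreimage {R : StarSubalgebra ℂ B} (t : B) (P : Submodule (↥R)ᵐᵒᵖ B) :
    Submodule (↥R)ᵐᵒᵖ B where
  carrier := {x | t * x ∈ P}
  add_mem' {x y} hx hy := by
    simpa only [Set.mem_ofPred_eq, mul_add] using P.add_mem hx hy
  zero_mem' := by simp
  smul_mem' c x hx := by
    have h := P.smul_mem c hx
    induction c using MulOpposite.rec' with
    | h a =>
      rw [op_smul_eq] at h
      simpa only [Set.mem_ofPred_eq, op_smul_eq, mul_assoc] using h

/-- The right `R`-module `p R^n` for an `n × n` matrix `p` over a ring `R`. -/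
def matrixModule {R : Type*} [Ring R] {n : ℕ} (p : Matrix (Fin n) (Fin n) R) :
    Submodule Rᵐᵒᵖ (Fin n → R) where
  carrier := Set.range p.mulVec
  add_mem' := by
    rintro _ _ ⟨v, rfl⟩ ⟨w, rfl⟩
    exact ⟨v + w, p.mulVec_add v w⟩
  zero_mem' := ⟨0, p.mulVec_zero⟩
  smul_mem' := by
    rintro c _ ⟨v, rfl⟩
    exact ⟨c • v, p.mulVec_smul c v⟩

end Modules

section Dimension

variable {H : Type*} [NormedAddCommGroup H] [InnerProductSpace ℂ H] [CompleteSpace H]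
variable (𝔐 : TracialAlgebra H) (R : StarSubalgebra ℂ (H →L[ℂ] H))

/-! In this section `R` stands for a von Neumann subalgebra of `M` (for instance `N`, or `M`
itself), with the restricted trace. -/

/-- The von Neumann dimension of an arbitrary right `R`-module `X`:
the supremum of `dim_R Q` over the finitely generated projective submodules `Q ⊆ X`.  The latter
are those isomorphic to `p R^n` for a projection `p ∈ M_n(R)`, and then `dim_R Q` is the dimension
`∑ i, τ (p i i)` of the completion `p L²(R)^n`. -/
def vnDim (X : Type*) [AddCommGroup X] [Module (↥R)ᵐᵒᵖ X] : ℝ≥0∞ :=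
  ⨆ (Q : Submodule (↥R)ᵐᵒᵖ X) (n : ℕ) (p : Matrix (Fin n) (Fin n) R)
    (_ : p.IsHermitian ∧ IsIdempotentElem p) (_ : Nonempty (Q ≃ₗ[(↥R)ᵐᵒᵖ] matrixModule p)),
    ENNReal.ofReal (∑ i, 𝔐.τ (p i i : H →L[ℂ] H)).re

/-- `L²(R)`, the closure of `R Ω` in `H`. -/
def L2 : Submodule ℂ H := (R.toSubalgebra.toSubmodule.map 𝔐.Λ).topologicalClosure

/-- The vector `Ω e_i` of `L²(R)^m ⊆ H^m`. -/
def basisVec {m : ℕ} (i : Fin m) : Amp H m := WithLp.toLp 2 (Pi.single i 𝔐.Ω)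

/-- The diagonal right action on `H^k`. -/
def ampAct {k : ℕ} (a : H →L[ℂ] H) (ξ : Amp H k) : Amp H k :=
  WithLp.toLp 2 fun i => 𝔐.ract a (ξ i)

variable {K : Type*} [NormedAddCommGroup K] [InnerProductSpace ℂ K]

/-- `V` is an isometric `R`-equivariant embedding of `F` into `L²(R)^m`, where `F` is a subspace,
invariant under `R`, of a space `K` with right action `act`. -/
def IsNormalEmbedding (act : (H →L[ℂ] H) → K → K) (F : Submodule ℂ K) {m : ℕ}
    (V : F →ₗᵢ[ℂ] Amp H m) : Prop :=
  (∀ ξ : F, ∀ i, V ξ i ∈ L2 𝔐 R) ∧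
    ∀ a ∈ R, ∀ ξ η : F, (η : K) = act a ξ → V η = ampAct 𝔐 a (V ξ)

open Classical in
/-- The trace `Tr_R` on the `R`-equivariant operators on a finitely generated normal right
`R`-module `F`: for an isometric equivariant embedding `V : F → L²(R)^m`, the operator `V S V*` is a
matrix `(S i j)` over `R` and `Tr_R S = ∑ i, τ (S i i)`.  It does not depend on `V`. -/
def normalTrace (act : (H →L[ℂ] H) → K → K) (F : Submodule ℂ K) [CompleteSpace F]
    (S : F →L[ℂ] F) : ℂ :=
  if h : ∃ m : ℕ, ∃ V : F →ₗᵢ[ℂ] Amp H m, IsNormalEmbedding 𝔐 R act F V then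
    ∑ i : Fin h.choose, inner ℂ (basisVec 𝔐 i) (h.choose_spec.choose
      (S (ContinuousLinearMap.adjoint h.choose_spec.choose.toContinuousLinearMap (basisVec 𝔐 i))))
  else 0

/-- The von Neumann dimension of a finitely generated normal right `R`-module `F`: if
`F ≅ p L²(R)^m` then it is `∑ i, τ (p i i)`, which is the trace of the identity of `F`. -/
def normalDim (act : (H →L[ℂ] H) → K → K) (F : Submodule ℂ K) [CompleteSpace F] : ℝ :=
  (normalTrace 𝔐 R act F (ContinuousLinearMap.id ℂ F)).re

/-- The compression `P_F S P_F|_F` of an operator `S` on `K` to a closed subspace `F`. -/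
def compress [CompleteSpace K] (F : Submodule ℂ K) [CompleteSpace F] (S : K →L[ℂ] K) :
    F →L[ℂ] F :=
  F.orthogonalProjectionOnto ∘L S ∘L F.subtypeL

variable {R}

/-- The closure in `H` of a right `R`-submodule of `M`. -/
def hilbertClosure (P : Submodule (↥R)ᵐᵒᵖ (H →L[ℂ] H)) : Submodule ℂ H :=
  ((toComplex P).map 𝔐.Λ).topologicalClosure

instance (P : Submodule (↥R)ᵐᵒᵖ (H →L[ℂ] H)) : CompleteSpace (hilbertClosure 𝔐 P) :=
  Submodule.topologicalClosure.completeSpace _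

instance (P : Submodule (↥R)ᵐᵒᵖ (H →L[ℂ] H)) (k : ℕ) :
    CompleteSpace (ampSubspace (hilbertClosure 𝔐 P) k) :=
  (isClosed_ampSubspace _ (Submodule.isClosed_topologicalClosure _) k).completeSpace_coe

/-- The state `φ_P(T) = Tr_R(P_F T P_F|_F) / dim_R P`, where `F` is the closure of `P` in `H`. -/
def phi (P : Submodule (↥R)ᵐᵒᵖ (H →L[ℂ] H)) (T : H →L[ℂ] H) : ℂ :=
  normalTrace 𝔐 R 𝔐.ract (hilbertClosure 𝔐 P) (compress (hilbertClosure 𝔐 P) T) /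
    ((vnDim 𝔐 R P).toReal : ℂ)

/-- The dimension of `E ⊆ H^k` relative to `P`:
`Tr_R(P_{F^k} P_E P_{F^k}|_{F^k}) / dim_R P`, where `F` is the closure of `P` in `H` and `P_E` is the
projection onto the closure of `E` in `H^k`. -/
def relDim (P : Submodule (↥R)ᵐᵒᵖ (H →L[ℂ] H)) {k : ℕ} (E : Submodule ℂ (Amp H k)) : ℝ :=
  (normalTrace 𝔐 R (ampAct 𝔐) (ampSubspace (hilbertClosure 𝔐 P) k)
    (compress (ampSubspace (hilbertClosure 𝔐 P) k) E.topologicalClosure.starProjection)).re /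
    (vnDim 𝔐 R P).toReal

/-- `ker (T|_{S^k})` for `T` a `k × k` matrix of operators and `S` a submodule, seen as a subspace of
`H^k` by means of `Λ`. -/
def kerOn {k : ℕ} (T : Matrix (Fin k) (Fin k) (H →L[ℂ] H))
    (S : Submodule (↥R)ᵐᵒᵖ (H →L[ℂ] H)) : Submodule ℂ (Amp H k) where
  carrier := {ξ | ∃ s : Fin k → (H →L[ℂ] H),
    (∀ i, s i ∈ S) ∧ T.mulVec s = 0 ∧ ξ = WithLp.toLp 2 fun i => 𝔐.Λ (s i)}
  add_mem' := by
    rintro _ _ ⟨s, hs, hTs, rfl⟩ ⟨t, ht, hTt, rfl⟩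
    refine ⟨s + t, fun i => S.add_mem (hs i) (ht i), by rw [Matrix.mulVec_add, hTs, hTt, add_zero], ?_⟩
    ext i
    simp
  zero_mem' := ⟨0, fun _ => S.zero_mem, Matrix.mulVec_zero T, by ext i; simp⟩
  smul_mem' := by
    rintro c _ ⟨s, hs, hTs, rfl⟩
    refine ⟨c • s, fun i => (toComplex S).smul_mem c (hs i), ?_, ?_⟩
    · rw [Matrix.mulVec_smul, hTs, smul_zero]
    · ext i
      simp

variable (R)

open Classical in
/-- The `τ`-preserving conditional expectation `E : M → R`: `E x` is the unique element of `R` with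
`τ (E x * a) = τ (x * a)` for all `a ∈ R`. -/
def condExp (x : H →L[ℂ] H) : H →L[ℂ] H :=
  if h : ∃ y ∈ R, ∀ a ∈ R, 𝔐.τ (y * a) = 𝔐.τ (x * a) then h.choose else 0

/-- The norm `‖⟨x, x⟩‖^{1/2}` on `M` of the `R`-valued inner product `⟨x, y⟩ = E (x* y)`. -/
def hilbertNorm (x : H →L[ℂ] H) : ℝ := √‖condExp 𝔐 R (star x * x)‖

variable {R}

/-- A right `R`-submodule `P ⊆ M` is complete if it is a Hilbert `R`-module, i.e. complete, for the
inner product `⟨x, y⟩ = E (x* y)`. -/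
def IsCompleteModule (P : Submodule (↥R)ᵐᵒᵖ (H →L[ℂ] H)) : Prop :=
  ∀ u : ℕ → (H →L[ℂ] H), (∀ n, u n ∈ P) →
    (∀ ε > 0, ∃ n₀, ∀ m ≥ n₀, ∀ n ≥ n₀, hilbertNorm 𝔐 R (u m - u n) < ε) →
    ∃ x ∈ P, Tendsto (fun n => hilbertNorm 𝔐 R (u n - x)) atTop (𝓝 0)

/-- The complete, non-zero, finitely generated projective right `R`-submodules of `A`. -/
structure IsAdmissible (A : StarSubalgebra ℂ (H →L[ℂ] H))
    (P : Submodule (↥R)ᵐᵒᵖ (H →L[ℂ] H)) : Prop where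
  subset : ∀ x ∈ P, x ∈ A
  complete : IsCompleteModule 𝔐 P
  ne_bot : P ≠ ⊥
  finite : Module.Finite (↥R)ᵐᵒᵖ P
  projective : Module.Projective (↥R)ᵐᵒᵖ P

/-- The norm `‖φ_P - τ‖` in the predual of `M`: the supremum of `|φ_P x - τ x|` over the unit ball
of `M`. -/
def traceDefect (P : Submodule (↥R)ᵐᵒᵖ (H →L[ℂ] H)) : ℝ≥0∞ :=
  ⨆ (x : H →L[ℂ] H) (_ : x ∈ 𝔐.M) (_ : ‖x‖ ≤ 1), ‖phi 𝔐 P x - 𝔐.τ x‖ₑ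

variable (R)

/-- The strong Følner property of `A` with respect to `R`. -/
def StrongFolner (A : StarSubalgebra ℂ (H →L[ℂ] H)) : Prop :=
  ∀ 𝒯 : Set (H →L[ℂ] H), 𝒯.Finite → (∀ t ∈ 𝒯, t ∈ A) → ∀ ε : ℝ, 0 < ε →
    ∃ P : Submodule (↥R)ᵐᵒᵖ (H →L[ℂ] H), IsAdmissible 𝔐 A P ∧
      (∀ t ∈ 𝒯, (vnDim 𝔐 R ↥(leftPreimage t P ⊓ P)).toReal / (vnDim 𝔐 R P).toReal > 1 - ε) ∧
      traceDefect 𝔐 P < ENNReal.ofReal ε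

variable {R}

/-- `(P n, S n)` is a strong Følner sequence for the set `𝒯` of operators in `A`. -/
structure IsStrongFolnerSeq (A : StarSubalgebra ℂ (H →L[ℂ] H)) (𝒯 : Set (H →L[ℂ] H))
    (P S : ℕ → Submodule (↥R)ᵐᵒᵖ (H →L[ℂ] H)) : Prop where
  admissible : ∀ n, IsAdmissible 𝔐 A (P n)
  le : ∀ n, S n ≤ P n
  maps : ∀ n, ∀ t ∈ 𝒯, ∀ x ∈ S n, t * x ∈ P n
  ratio : Tendsto (fun n => (vnDim 𝔐 R (S n)).toReal / (vnDim 𝔐 R (P n)).toReal) atTop (𝓝 1)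
  trace : Tendsto (fun n => traceDefect 𝔐 (P n)) atTop (𝓝 0)

/-- `A` is dense in `M` for the strong operator topology. -/
def IsStronglyDense (A : StarSubalgebra ℂ (H →L[ℂ] H)) (M : VonNeumannAlgebra H) : Prop :=
  ∀ x ∈ M, ∀ s : Finset H, ∀ ε : ℝ, 0 < ε → ∃ a ∈ A, ∀ ξ ∈ s, ‖x ξ - a ξ‖ < ε

end Dimension

end FolnerDim

end

noncomputable section

set_option linter.unusedSectionVars false

namespace FolnerDim

/-! ### Projections on a Hilbert space. -/

section Hilbert

variable {K : Type*} [NormedAddCommGroup K] [InnerProductSpace ℂ K] [CompleteSpace K]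

/-! The relative dimension of `ker (T|_{S_n^k})` is squeezed between two quantities that converge to
the dimension of `ker T`. For a closed subspace `L` of `H^k` invariant under the commutant of `M`,
the diagonal entries of the projection onto `L` lie in the unit ball of `M`. Since `φ_{P_n} → τ` in
norm, the dimension of `L` relative to `P_n` converges to the trace of that projection. This is
applied to `ker T` and to the closure of the range of `T`.

Upper bound: `ker (T|_{S_n^k})` lies in `ker T`. Lower bound: a rank inequality over `N`
(`mul_re_trace_le`). For each finitely generated projective `Q ⊆ S_n`, `k dim Q` is at most the
trace of the compressed projection onto `ker (T|_{S_n^k})` plus that of the compressed projection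
onto the closed range of `T`, because `T` maps `S_n^k` into `P_n^k`. Taking the supremum over `Q`
and dividing by `dim P_n` gives `relDim_bounds`. In the limit the lower bound is `k` minus the
dimension of the closed range, and `re_tr_range_le` shows that this is at least the dimension of
`ker T`.

Two tools carry the rank inequality. Comparison of dimensions (`re_tr_le_of_injective`) says that an
injective equivariant map does not decrease the trace; it is proved from the trace property and the
mean ergodic theorem, without polar decomposition. The commutation theorem (`exists_mem_apply_Ω_eq`,
`exists_coeff`) says that equivariant operators on `L²(N)^ι` have entries in `N`, so that Hilbert
space kernels are generated by algebraic vectors, which is what `S_n` and `ker (T|_{S_n^k})` consist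
of. -/

theorem starProjection_comm {L : Submodule ℂ K} [L.HasOrthogonalProjection] {f : K →L[ℂ] K}
    (h1 : ∀ ξ ∈ L, f ξ ∈ L) (h2 : ∀ ξ ∈ L, star f ξ ∈ L) (ξ : K) :
    f (L.starProjection ξ) = L.starProjection (f ξ) := by
  refine (Submodule.eq_starProjection_of_mem_of_inner_eq_zero
    (h1 _ (L.starProjection_apply_mem ξ)) fun w hw => ?_).symm
  rw [← map_sub, ← ContinuousLinearMap.adjoint_inner_right]
  exact L.starProjection_inner_eq_zero _ _ (h2 w hw)

theorem isStarProjection_starProjection (L : Submodule ℂ K) [L.HasOrthogonalProjection] :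
    IsStarProjection L.starProjection :=
  ⟨L.isIdempotentElem_starProjection, isSelfAdjoint_starProjection L⟩

theorem re_inner_isStarProjection {d : K →L[ℂ] K} (hd : IsStarProjection d) (ξ : K) :
    (inner ℂ ξ (d ξ)).re = ‖d ξ‖ ^ 2 := by
  have h : d * d = d := hd.isIdempotentElem
  have h2 : star d = d := hd.isSelfAdjoint
  have : inner ℂ ξ (d ξ) = inner ℂ (d ξ) (d ξ) := by
    conv_lhs => rw [← h, mul_apply_eq_comp, ← h2, ContinuousLinearMap.star_eq_adjoint,
      ContinuousLinearMap.adjoint_inner_right, ← ContinuousLinearMap.star_eq_adjoint, h2]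
  rw [this, inner_self_eq_norm_sq_to_K]
  norm_cast

end Hilbert

variable {H : Type*} [NormedAddCommGroup H] [InnerProductSpace ℂ H] [CompleteSpace H]

/-! ### The modular conjugation, the right action and `L²(R)`. -/

namespace TracialAlgebra

variable (𝔐 : TracialAlgebra H)

theorem dense_induction {p : H → Prop} (hp : IsClosed {ξ | p ξ})
    (h : ∀ a ∈ 𝔐.M, p (a 𝔐.Ω)) (ξ : H) : p ξ := by
  refine 𝔐.cyclic.induction (P := p) ?_ hp ξ
  rintro _ ⟨x, hx, rfl⟩
  exact h x hx

/-- On the dense set `M Ω` this is the trace identity `τ (a b) = τ (b a)`; continuity does the rest.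
-/
theorem inner_J (ξ η : H) : inner ℂ (𝔐.J ξ) η = inner ℂ (𝔐.J η) ξ := by
  refine 𝔐.dense_induction (p := fun ξ => inner ℂ (𝔐.J ξ) η = inner ℂ (𝔐.J η) ξ)
    (isClosed_eq (by fun_prop) (by fun_prop)) (fun a ha => ?_) ξ
  refine 𝔐.dense_induction (p := fun η => inner ℂ (𝔐.J (a 𝔐.Ω)) η = inner ℂ (𝔐.J η) (a 𝔐.Ω))
    (isClosed_eq (by fun_prop) (by fun_prop)) (fun b hb => ?_) η
  rw [𝔐.J_apply a ha, 𝔐.J_apply b hb, ContinuousLinearMap.star_eq_adjoint,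
    ContinuousLinearMap.star_eq_adjoint, ContinuousLinearMap.adjoint_inner_left,
    ContinuousLinearMap.adjoint_inner_left]
  exact 𝔐.tracial a ha b hb

@[simp] theorem J_J (ξ : H) : 𝔐.J (𝔐.J ξ) = ξ := by
  refine 𝔐.dense_induction (p := fun ξ => 𝔐.J (𝔐.J ξ) = ξ)
    (isClosed_eq (by fun_prop) (by fun_prop)) (fun a ha => ?_) ξ
  rw [𝔐.J_apply a ha, 𝔐.J_apply _ (star_mem ha), star_star]

/-- The operator `ξ ↦ J (y (J ξ))`. -/
def conjJ (y : H →L[ℂ] H) : H →L[ℂ] H :=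
  (𝔐.J.toContinuousLinearEquiv : H →SL[starRingEnd ℂ] H).comp
    (y.comp (𝔐.J.toContinuousLinearEquiv : H →SL[starRingEnd ℂ] H))

@[simp] theorem conjJ_apply (y : H →L[ℂ] H) (ξ : H) : 𝔐.conjJ y ξ = 𝔐.J (y (𝔐.J ξ)) := rfl

theorem star_conjJ (y : H →L[ℂ] H) : star (𝔐.conjJ y) = 𝔐.conjJ (star y) := by
  rw [ContinuousLinearMap.star_eq_adjoint]
  refine ((ContinuousLinearMap.eq_adjoint_iff _ _).2 fun ξ η => ?_).symm
  rw [conjJ_apply, conjJ_apply, 𝔐.inner_J, ContinuousLinearMap.star_eq_adjoint,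
    ContinuousLinearMap.adjoint_inner_right, ← inner_conj_symm ξ, 𝔐.inner_J, inner_conj_symm]

/-- The right action of `a` as a continuous linear operator. -/
def ractL (a : H →L[ℂ] H) : H →L[ℂ] H := 𝔐.conjJ (star a)

theorem star_ractL (a : H →L[ℂ] H) : star (𝔐.ractL a) = 𝔐.ractL (star a) :=
  𝔐.star_conjJ _

theorem ractL_apply {a x : H →L[ℂ] H} (ha : a ∈ 𝔐.M) (hx : x ∈ 𝔐.M) :
    𝔐.ractL a (x 𝔐.Ω) = x (a 𝔐.Ω) := 𝔐.ract_apply a x ha hx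

theorem ractL_Ω {a : H →L[ℂ] H} (ha : a ∈ 𝔐.M) : 𝔐.ractL a 𝔐.Ω = a 𝔐.Ω := by
  simpa using 𝔐.ractL_apply ha (one_mem 𝔐.M)

theorem ractL_commute {a x : H →L[ℂ] H} (ha : a ∈ 𝔐.M) (hx : x ∈ 𝔐.M) (ξ : H) :
    𝔐.ractL a (x ξ) = x (𝔐.ractL a ξ) := by
  refine 𝔐.dense_induction (p := fun ξ => 𝔐.ractL a (x ξ) = x (𝔐.ractL a ξ))
    (isClosed_eq (by fun_prop) (by fun_prop)) (fun b hb => ?_) ξ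
  have h := 𝔐.ractL_apply ha (mul_mem hx hb)
  rw [mul_apply_eq_comp, mul_apply_eq_comp] at h
  rw [𝔐.ractL_apply ha hb, h]

/-- `Ω` is separating because it is cyclic for the right action, which commutes with `x`. This turns
identities between vectors back into identities in `M`. -/
theorem eq_zero_of_apply_Ω {x : H →L[ℂ] H} (hx : x ∈ 𝔐.M) (h : x 𝔐.Ω = 0) : x = 0 := by
  ext ξ
  refine 𝔐.dense_induction (p := fun ξ => x ξ = (0 : H →L[ℂ] H) ξ)
    (isClosed_eq (by fun_prop) (by fun_prop)) (fun b hb => ?_) ξ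
  rw [← 𝔐.ractL_Ω hb, ← 𝔐.ractL_commute hb hx, h]
  simp

variable (R : StarSubalgebra ℂ (H →L[ℂ] H))

instance : CompleteSpace (L2 𝔐 R) := Submodule.topologicalClosure.completeSpace _

/-- The orthogonal projection of `H` onto `L²(R)`. -/
def projL2 : H →L[ℂ] H := (L2 𝔐 R).starProjection

theorem isStarProjection_projL2 : IsStarProjection (𝔐.projL2 R) :=
  isStarProjection_starProjection _

theorem star_projL2 : star (𝔐.projL2 R) = 𝔐.projL2 R := (𝔐.isStarProjection_projL2 R).isSelfAdjoint

variable {R}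

theorem apply_Ω_mem_L2 {a : H →L[ℂ] H} (ha : a ∈ R) : a 𝔐.Ω ∈ L2 𝔐 R :=
  Submodule.le_topologicalClosure _ ⟨a, ha, rfl⟩

theorem projL2_of_mem {ξ : H} (hξ : ξ ∈ L2 𝔐 R) : 𝔐.projL2 R ξ = ξ :=
  Submodule.starProjection_eq_self_iff.2 hξ

theorem projL2_mem (ξ : H) : 𝔐.projL2 R ξ ∈ L2 𝔐 R := Submodule.starProjection_apply_mem _ _

theorem projL2_apply_Ω {a : H →L[ℂ] H} (ha : a ∈ R) : 𝔐.projL2 R (a 𝔐.Ω) = a 𝔐.Ω :=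
  𝔐.projL2_of_mem (𝔐.apply_Ω_mem_L2 ha)

theorem L2_induction {p : H → Prop} (hp : IsClosed {ξ | p ξ})
    (h : ∀ a ∈ R, p (a 𝔐.Ω)) {ξ : H} (hξ : ξ ∈ L2 𝔐 R) : p ξ := by
  have : (L2 𝔐 R : Set H) ⊆ {ξ | p ξ} := by
    rw [L2, Submodule.topologicalClosure_coe]
    refine closure_minimal ?_ hp
    rintro _ ⟨a, ha, rfl⟩
    exact h a ha
  exact this hξ

theorem eq_of_inner_L2 {ξ η : H} (hξ : ξ ∈ L2 𝔐 R) (hη : η ∈ L2 𝔐 R)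
    (h : ∀ a ∈ R, inner ℂ ξ (a 𝔐.Ω) = inner ℂ η (a 𝔐.Ω)) : ξ = η := by
  have : inner ℂ (ξ - η) (ξ - η) = (0 : ℂ) :=
    𝔐.L2_induction (p := fun ζ => inner ℂ (ξ - η) ζ = 0) (isClosed_eq (by fun_prop) (by fun_prop))
      (fun a ha => by rw [inner_sub_left, h a ha, sub_self]) (Submodule.sub_mem _ hξ hη)
  exact sub_eq_zero.1 (inner_self_eq_zero.1 this)

variable (hR : R ≤ 𝔐.M.toStarSubalgebra)
include hR

theorem J_mem_L2 {ξ : H} (hξ : ξ ∈ L2 𝔐 R) : 𝔐.J ξ ∈ L2 𝔐 R := by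
  refine 𝔐.L2_induction (p := fun ξ => 𝔐.J ξ ∈ L2 𝔐 R)
    ((Submodule.isClosed_topologicalClosure _).preimage 𝔐.J.continuous) (fun a ha => ?_) hξ
  rw [𝔐.J_apply a (hR ha)]
  exact 𝔐.apply_Ω_mem_L2 (star_mem ha)

omit hR in
theorem apply_mem_L2 {a : H →L[ℂ] H} (ha : a ∈ R) {ξ : H} (hξ : ξ ∈ L2 𝔐 R) : a ξ ∈ L2 𝔐 R := by
  refine 𝔐.L2_induction (p := fun ξ => a ξ ∈ L2 𝔐 R)
    ((Submodule.isClosed_topologicalClosure _).preimage a.continuous) (fun b hb => ?_) hξ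
  exact 𝔐.apply_Ω_mem_L2 (mul_mem ha hb)

theorem ractL_mem_L2 {a : H →L[ℂ] H} (ha : a ∈ R) {ξ : H} (hξ : ξ ∈ L2 𝔐 R) :
    𝔐.ractL a ξ ∈ L2 𝔐 R :=
  𝔐.J_mem_L2 hR (𝔐.apply_mem_L2 (star_mem ha) (𝔐.J_mem_L2 hR hξ))

omit hR in
theorem projL2_commute {a : H →L[ℂ] H} (ha : a ∈ R) (ξ : H) :
    a (𝔐.projL2 R ξ) = 𝔐.projL2 R (a ξ) :=
  starProjection_comm (fun _ h => 𝔐.apply_mem_L2 ha h)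
    (fun _ h => 𝔐.apply_mem_L2 (star_mem ha) h) ξ

theorem projL2_ractL {a : H →L[ℂ] H} (ha : a ∈ R) (ξ : H) :
    𝔐.ractL a (𝔐.projL2 R ξ) = 𝔐.projL2 R (𝔐.ractL a ξ) :=
  starProjection_comm (fun _ h => 𝔐.ractL_mem_L2 hR ha h)
    (fun _ h => by rw [star_ractL]; exact 𝔐.ractL_mem_L2 hR (star_mem ha) h) ξ

theorem projL2_J (ξ : H) : 𝔐.J (𝔐.projL2 R ξ) = 𝔐.projL2 R (𝔐.J ξ) := by
  refine (Submodule.eq_starProjection_of_mem_of_inner_eq_zero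
    (𝔐.J_mem_L2 hR (𝔐.projL2_mem ξ)) fun w hw => ?_).symm
  rw [← map_sub, 𝔐.inner_J, ← inner_conj_symm]
  have := (L2 𝔐 R).starProjection_inner_eq_zero ξ _ (𝔐.J_mem_L2 hR hw)
  rw [projL2, this, map_zero]

end TracialAlgebra

end FolnerDim

namespace FolnerDim

/-! ### The commutation theorem for `N` on `L²(N)`. -/

section Commutation

variable {H : Type*} [NormedAddCommGroup H] [InnerProductSpace ℂ H] [CompleteSpace H]

/-- The absolute value of `b` has the same norms on vectors as `b`, and commutes with `s` by
functional calculus, so `s` can be moved to the left. -/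
theorem norm_apply_le_of_commute {b s : H →L[ℂ] H} (h : Commute (star b * b) s) (ξ : H) :
    ‖b (s ξ)‖ ≤ ‖s‖ * ‖b ξ‖ := by
  have hb : 0 ≤ star b * b := star_mul_self_nonneg b
  set r := CFC.sqrt (star b * b) with hr
  have hrr : r * r = star b * b := CFC.sqrt_mul_sqrt_self _ hb
  have hrs : star r = r := (CFC.sqrt_nonneg (star b * b)).isSelfAdjoint
  have hcomm : Commute r s := by
    rw [hr, CFC.sqrt]
    exact Commute.cfcₙ_nnreal h _
  have key : ∀ η : H, ‖b η‖ = ‖r η‖ := fun η => by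
    have : inner ℂ (b η) (b η) = inner ℂ (r η) (r η) := by
      rw [← ContinuousLinearMap.adjoint_inner_right, ← ContinuousLinearMap.adjoint_inner_right,
        ← ContinuousLinearMap.star_eq_adjoint, ← ContinuousLinearMap.star_eq_adjoint,
        ← mul_apply_eq_comp, ← mul_apply_eq_comp, hrs, hrr]
    rw [@norm_eq_sqrt_re_inner ℂ, @norm_eq_sqrt_re_inner ℂ _ _ _ _ (r η), this]
  rw [key, key, ← mul_apply_eq_comp, hcomm.eq, mul_apply_eq_comp]
  exact s.le_opNorm _

namespace TracialAlgebra

variable (𝔐 : TracialAlgebra H) {N : VonNeumannAlgebra H}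

theorem ractL_mem_commutant (hN : N.toStarSubalgebra ≤ 𝔐.M.toStarSubalgebra) {a : H →L[ℂ] H}
    (ha : a ∈ 𝔐.M) : 𝔐.ractL a ∈ N.commutant := by
  rw [VonNeumannAlgebra.mem_commutant_iff]
  intro g hg
  ext ξ
  exact (𝔐.ractL_commute ha (hN hg) ξ).symm

theorem projL2_mem_commutant : 𝔐.projL2 N.toStarSubalgebra ∈ N.commutant := by
  rw [VonNeumannAlgebra.mem_commutant_iff]
  intro g hg
  ext ξ
  exact 𝔐.projL2_commute hg ξ

/-- Pairing with `a Ω`, `a ∈ N`, reduces the claim to `a c = c a`; such vectors determine an element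
of `L²(N)`. Thus `J` acts on these vectors of the commutant as it does on those of `M`. -/
theorem J_apply_of_commute (hN : N.toStarSubalgebra ≤ 𝔐.M.toStarSubalgebra) {c : H →L[ℂ] H}
    (hc : c ∈ N.commutant)
    (h1 : c 𝔐.Ω ∈ L2 𝔐 N.toStarSubalgebra) (h2 : star c 𝔐.Ω ∈ L2 𝔐 N.toStarSubalgebra) :
    𝔐.J (c 𝔐.Ω) = star c 𝔐.Ω := by
  refine 𝔐.eq_of_inner_L2 (𝔐.J_mem_L2 hN h1) h2 fun a ha => ?_
  have hca : a * c = c * a := VonNeumannAlgebra.mem_commutant_iff.1 hc a ha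
  rw [𝔐.inner_J, 𝔐.J_apply a (hN ha), ContinuousLinearMap.star_eq_adjoint,
    ContinuousLinearMap.star_eq_adjoint, ContinuousLinearMap.adjoint_inner_left,
    ContinuousLinearMap.adjoint_inner_left, ← mul_apply_eq_comp, ← mul_apply_eq_comp, hca]

variable {y : H →L[ℂ] H}

/-- `J y J` lies in the commutant of `N`, so `y` acts there like a right multiplication: `y z Ω = z
t* Ω` with `t = J y J`. Left multiplication by `c` then commutes with `y`. -/
theorem commute_corner (hN : N.toStarSubalgebra ≤ 𝔐.M.toStarSubalgebra)
    (hy : ∀ a ∈ N, ∀ ξ, y (𝔐.ractL a ξ) = 𝔐.ractL a (y ξ))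
    (hye : Commute y (𝔐.projL2 N.toStarSubalgebra)) {c : H →L[ℂ] H}
    (hc : c ∈ N.commutant) (hce : Commute c (𝔐.projL2 N.toStarSubalgebra)) {ξ : H}
    (hξ : ξ ∈ L2 𝔐 N.toStarSubalgebra) : y (c ξ) = c (y ξ) := by
  set e := 𝔐.projL2 N.toStarSubalgebra with he
  have hΩ : e 𝔐.Ω = 𝔐.Ω := by simpa using 𝔐.projL2_apply_Ω (one_mem N.toStarSubalgebra)
  have hmem : ∀ z : H →L[ℂ] H, Commute z e → z 𝔐.Ω ∈ L2 𝔐 N.toStarSubalgebra := fun z hz => by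
    rw [← hΩ, ← mul_apply_eq_comp, hz.eq, mul_apply_eq_comp]
    exact 𝔐.projL2_mem _
  have hstar : ∀ z : H →L[ℂ] H, Commute z e → Commute (star z) e := fun z hz => by
    have := hz.star_star
    rwa [he, star_projL2] at this
  have hJ : ∀ z ∈ N.commutant, Commute z e → 𝔐.J (z 𝔐.Ω) = star z 𝔐.Ω := fun z hz hze =>
    𝔐.J_apply_of_commute hN hz (hmem z hze) (hmem _ (hstar z hze))
  set t := 𝔐.conjJ y with ht
  have htN : t ∈ N.commutant := by
    rw [VonNeumannAlgebra.mem_commutant_iff]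
    intro g hg
    ext ξ
    have := hy (star g) (star_mem hg) (𝔐.J ξ)
    simp only [ractL, conjJ_apply, star_star, J_J] at this
    simp only [mul_apply_eq_comp, ht, conjJ_apply]
    rw [this, J_J]
  have hte : Commute t e := by
    ext ξ
    have h := DFunLike.congr_fun hye.eq (𝔐.J ξ)
    simp only [mul_apply_eq_comp] at h
    simp only [mul_apply_eq_comp, ht, conjJ_apply]
    rw [𝔐.projL2_J hN, h, 𝔐.projL2_J hN]
  refine 𝔐.L2_induction (p := fun ξ => y (c ξ) = c (y ξ))
    (isClosed_eq (by fun_prop) (by fun_prop)) (fun a ha => ?_) hξ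
  have hyt : ∀ η, y η = 𝔐.J (t (𝔐.J η)) := fun η => by simp [ht]
  set d := 𝔐.ractL a with hd
  have hdN : d ∈ N.commutant := 𝔐.ractL_mem_commutant hN (hN ha)
  have hde : Commute d e := by ext ξ; exact 𝔐.projL2_ractL hN ha ξ
  have key : ∀ z ∈ N.commutant, Commute z e → y (z 𝔐.Ω) = z (star t 𝔐.Ω) := fun z hz hze => by
    rw [hyt, hJ z hz hze, ← mul_apply_eq_comp,
      hJ _ (mul_mem htN (star_mem hz)) (hte.mul_left (hstar z hze)), star_mul, star_star,
      mul_apply_eq_comp]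
  -- The formula `key` is used twice, for `d` and for `c * d`, where `d Ω = a Ω`.
  rw [← 𝔐.ractL_Ω (hN ha), ← hd, key d hdN hde]
  have := key (c * d) (mul_mem hc hdN) (hce.mul_left hde)
  rwa [mul_apply_eq_comp, mul_apply_eq_comp] at this

/-- The commutation theorem for `N` on `L²(N)`: an operator on `L²(N)` commuting with the right
action of `N` is left multiplication by an element of `N`. -/
theorem exists_mem_apply_Ω_eq (hN : N.toStarSubalgebra ≤ 𝔐.M.toStarSubalgebra)
    (hy : ∀ a ∈ N, ∀ ξ, y (𝔐.ractL a ξ) = 𝔐.ractL a (y ξ))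
    (hye : Commute y (𝔐.projL2 N.toStarSubalgebra)) : ∃ n ∈ N, n 𝔐.Ω = y 𝔐.Ω := by
  set e := 𝔐.projL2 N.toStarSubalgebra with he
  have hee : e * e = e := (𝔐.isStarProjection_projL2 _).isIdempotentElem
  have hes : star e = e := 𝔐.star_projL2 _
  have heN : e ∈ N.commutant := 𝔐.projL2_mem_commutant
  have hΩ : e 𝔐.Ω = 𝔐.Ω := by simpa using 𝔐.projL2_apply_Ω (one_mem N.toStarSubalgebra)
  have hyΩ : e (y 𝔐.Ω) = y 𝔐.Ω := by rw [← mul_apply_eq_comp, ← hye.eq, mul_apply_eq_comp, hΩ]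
  -- This bound makes `a Ω ↦ a (y Ω)` a well-defined bounded map on the orbit of `Ω` under the
  -- commutant. It is obtained by cutting `a` down to `a * e`: then `e a* a e` satisfies the
  -- assumptions of `commute_corner`, hence commutes with `y`.
  have bound : ∀ a ∈ N.commutant, ‖a (y 𝔐.Ω)‖ ≤ ‖y‖ * ‖a 𝔐.Ω‖ := by
    intro a ha
    obtain ⟨c, hc⟩ : ∃ c, c = star (a * e) * (a * e) := ⟨_, rfl⟩
    have hcN : c ∈ N.commutant := hc ▸ mul_mem (star_mem (mul_mem ha heN)) (mul_mem ha heN)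
    have hec : e * c = c := by
      rw [hc, star_mul, hes]
      simp only [← mul_assoc, hee]
    have hce : c * e = c := by rw [hc, mul_assoc, mul_assoc, hee]
    have hcomm : Commute c y := by
      have h1 : y * c * e = c * y * e := by
        ext ξ
        exact 𝔐.commute_corner hN hy hye hcN (hce.trans hec.symm) (𝔐.projL2_mem ξ)
      rw [mul_assoc, hce, mul_assoc, hye.eq, ← mul_assoc, hce] at h1
      exact h1.symm
    have h := norm_apply_le_of_commute (hc ▸ hcomm) 𝔐.Ω
    rwa [mul_apply_eq_comp, mul_apply_eq_comp, hyΩ, hΩ] at h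
  let S := N.commutant.toStarSubalgebra.toSubalgebra.toSubmodule
  let ev : S →ₗ[ℂ] H := 𝔐.Λ ∘ₗ S.subtype
  let f : S →ₗ[ℂ] H := (ContinuousLinearMap.apply ℂ H (y 𝔐.Ω)).toLinearMap ∘ₗ S.subtype
  -- The right action of `M` lies in the commutant of `N` and already moves `Ω` through `M Ω`.
  have hdense : DenseRange ev := by
    refine 𝔐.cyclic.mono ?_
    rintro _ ⟨a, ha, rfl⟩
    exact ⟨⟨𝔐.ractL a, 𝔐.ractL_mem_commutant hN ha⟩, 𝔐.ractL_Ω ha⟩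
  have hext : ∀ a ∈ N.commutant, f.extendOfNorm ev (a 𝔐.Ω) = a (y 𝔐.Ω) := fun a ha =>
    LinearMap.extendOfNorm_eq (f := f) (e := ev) hdense ⟨‖y‖, fun a => bound a a.2⟩ ⟨a, ha⟩
  refine ⟨f.extendOfNorm ev, ?_, ?_⟩
  -- The extended map commutes with the commutant of `N` by construction, so it lies in `N` by the
  -- bicommutant theorem.
  · rw [← N.commutant_commutant, VonNeumannAlgebra.mem_commutant_iff]
    intro g hg
    refine DFunLike.ext' (hdense.equalizer (by fun_prop) (by fun_prop) (funext fun a => ?_))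
    change g (f.extendOfNorm ev ((a : H →L[ℂ] H) 𝔐.Ω))
      = f.extendOfNorm ev (g ((a : H →L[ℂ] H) 𝔐.Ω))
    have h := hext _ (mul_mem hg a.2)
    rw [mul_apply_eq_comp, mul_apply_eq_comp] at h
    rw [hext _ a.2, h]
  · simpa using hext 1 (one_mem _)

end TracialAlgebra

end Commutation

end FolnerDim

namespace FolnerDim

/-! ### Operators between direct sums, and the trace. -/

section Amplification

variable {H : Type*} [NormedAddCommGroup H] [InnerProductSpace ℂ H]

/-- The Hilbert space direct sum of copies of `H` indexed by `ι`. -/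
abbrev HSum (H : Type*) [NormedAddCommGroup H] (ι : Type*) [Fintype ι] : Type _ :=
  PiLp 2 (fun _ : ι => H)

variable {ι κ ν : Type*} [Fintype ι] [Fintype κ] [Fintype ν]

/-- The operator between direct sums given by a matrix of operators. -/
def matL (T : Matrix κ ι (H →L[ℂ] H)) : HSum H ι →L[ℂ] HSum H κ :=
  (PiLp.continuousLinearEquiv 2 ℂ (fun _ : κ => H)).symm.toContinuousLinearMap ∘L
    ContinuousLinearMap.pi fun i => ∑ j, T i j ∘L PiLp.proj 2 (fun _ : ι => H) j

theorem matL_apply (T : Matrix κ ι (H →L[ℂ] H)) (ξ : HSum H ι) (i : κ) :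
    matL T ξ i = ∑ j, T i j (ξ j) := by
  simp [matL]

/-- The diagonal operator on a direct sum given by an operator on `H`. -/
def diagL (f : H →L[ℂ] H) : HSum H ι →L[ℂ] HSum H ι :=
  (PiLp.continuousLinearEquiv 2 ℂ (fun _ : ι => H)).symm.toContinuousLinearMap ∘L
    ContinuousLinearMap.pi fun i => f ∘L PiLp.proj 2 (fun _ : ι => H) i

@[simp] theorem diagL_apply (f : H →L[ℂ] H) (ξ : HSum H ι) (i : ι) : diagL f ξ i = f (ξ i) := rfl

/-- The `i`-th coordinate as a continuous linear map. -/
def coord (i : ι) : HSum H ι →L[ℂ] H := PiLp.proj 2 (fun _ : ι => H) i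

@[simp] theorem coord_apply (ξ : HSum H ι) (i : ι) : coord i ξ = ξ i := rfl

variable [CompleteSpace H]

theorem star_diagL (f : H →L[ℂ] H) :
    star (diagL f : HSum H ι →L[ℂ] HSum H ι) = diagL (star f) := by
  rw [ContinuousLinearMap.star_eq_adjoint]
  refine ((ContinuousLinearMap.eq_adjoint_iff _ _).2 fun ξ η => ?_).symm
  simp only [PiLp.inner_apply, diagL_apply, ContinuousLinearMap.star_eq_adjoint,
    ContinuousLinearMap.adjoint_inner_left]

theorem inner_diagL_left (f : H →L[ℂ] H) (ξ η : HSum H ι) :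
    inner ℂ (diagL f ξ) η = inner ℂ ξ (diagL (star f) η) := by
  rw [← star_diagL, ContinuousLinearMap.star_eq_adjoint, ContinuousLinearMap.adjoint_inner_right]

variable [DecidableEq ι] [DecidableEq κ]

omit [CompleteSpace H] in
theorem inner_toLp_single (i : ι) (ξ : H) (η : HSum H ι) :
    inner ℂ (WithLp.toLp 2 (Pi.single i ξ) : HSum H ι) η = inner ℂ ξ (η i) := by
  rw [PiLp.inner_apply, Finset.sum_eq_single i]
  · simp
  · intro j _ hj
    simp [Pi.single_eq_of_ne hj]
  · simp

theorem adjoint_coord_apply (i : ι) (ξ : H) :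
    ContinuousLinearMap.adjoint (coord i : HSum H ι →L[ℂ] H) ξ
      = WithLp.toLp 2 (Pi.single i ξ) := by
  refine ext_inner_right ℂ fun η => ?_
  rw [ContinuousLinearMap.adjoint_inner_left, inner_toLp_single, coord_apply]

theorem sum_adjoint_coord_comp (ξ : HSum H ι) :
    ∑ i, ContinuousLinearMap.adjoint (coord i : HSum H ι →L[ℂ] H) (ξ i) = ξ := by
  ext j
  simp only [adjoint_coord_apply, WithLp.ofLp_sum, Finset.sum_apply]
  simp [Pi.single_apply]

/-- An operator between direct sums that commutes with the diagonal action of a set of operators. -/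
def Intertwines (s : Set (H →L[ℂ] H)) (Z : HSum H ι →L[ℂ] HSum H κ) : Prop :=
  ∀ f ∈ s, ∀ ξ, Z (diagL f ξ) = diagL f (Z ξ)

namespace Intertwines

variable {s : Set (H →L[ℂ] H)} {Z : HSum H ι →L[ℂ] HSum H κ}

omit [CompleteSpace H] [DecidableEq ι] [DecidableEq κ]

theorem comp {Y : HSum H κ →L[ℂ] HSum H ν} (hY : Intertwines s Y) (hZ : Intertwines s Z) :
    Intertwines s (Y ∘L Z) := fun f hf ξ => by
  simp only [ContinuousLinearMap.comp_apply, hZ f hf, hY f hf]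

theorem one : Intertwines s (1 : HSum H ι →L[ℂ] HSum H ι) := fun _ _ _ => rfl

theorem sub {Y : HSum H ι →L[ℂ] HSum H κ} (hY : Intertwines s Y) (hZ : Intertwines s Z) :
    Intertwines s (Y - Z) := fun f hf ξ => by
  simp [hZ f hf, hY f hf]

theorem smul (c : ℂ) (hZ : Intertwines s Z) : Intertwines s (c • Z) := fun f hf ξ => by
  simp [hZ f hf]

theorem pow {Y : HSum H ι →L[ℂ] HSum H ι} (hY : Intertwines s Y) (n : ℕ) :
    Intertwines s (Y ^ n) := by
  induction n with
  | zero => exact one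
  | succ n ih => rw [pow_succ]; exact ih.comp hY

variable [CompleteSpace H]

theorem adjoint (hs : ∀ f ∈ s, star f ∈ s) (hZ : Intertwines s Z) :
    Intertwines s (ContinuousLinearMap.adjoint Z) := fun f hf ξ => by
  refine ext_inner_right ℂ fun η => ?_
  rw [ContinuousLinearMap.adjoint_inner_left, inner_diagL_left, inner_diagL_left,
    ContinuousLinearMap.adjoint_inner_left, hZ _ (hs f hf)]

theorem starProjection (hs : ∀ f ∈ s, star f ∈ s) (L : Submodule ℂ (HSum H ι))
    [L.HasOrthogonalProjection] (hL : ∀ f ∈ s, ∀ ξ ∈ L, diagL f ξ ∈ L) :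
    Intertwines s L.starProjection := fun f hf ξ =>
  (starProjection_comm (hL f hf) (fun η hη => by
    rw [star_diagL]; exact hL _ (hs f hf) η hη) ξ).symm

end Intertwines

namespace TracialAlgebra

variable (𝔐 : TracialAlgebra H) (R : StarSubalgebra ℂ (H →L[ℂ] H))

/-- The right action of `R`, as a set of operators. -/
def ractSet : Set (H →L[ℂ] H) := 𝔐.ractL '' R

/-- The right action of `R` and the projection onto `L²(R)`. -/
def eqvSet : Set (H →L[ℂ] H) := insert (𝔐.projL2 R) (𝔐.ractSet R)

variable {R}

theorem star_mem_ractSet {f : H →L[ℂ] H} (hf : f ∈ 𝔐.ractSet R) : star f ∈ 𝔐.ractSet R := by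
  obtain ⟨a, ha, rfl⟩ := hf
  exact ⟨star a, star_mem ha, (𝔐.star_ractL a).symm⟩

theorem star_mem_eqvSet {f : H →L[ℂ] H} (hf : f ∈ 𝔐.eqvSet R) : star f ∈ 𝔐.eqvSet R := by
  obtain rfl | hf := hf
  · rw [star_projL2]; exact Or.inl rfl
  · exact Or.inr (𝔐.star_mem_ractSet hf)

omit [DecidableEq ι] [DecidableEq κ] in
theorem intertwines_eqvSet {Z : HSum H ι →L[ℂ] HSum H κ} (h : Intertwines (𝔐.ractSet R) Z)
    (h1 : ∀ ξ, diagL (𝔐.projL2 R) (Z ξ) = Z ξ) (h2 : ∀ ξ, Z (diagL (𝔐.projL2 R) ξ) = Z ξ) :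
    Intertwines (𝔐.eqvSet R) Z := by
  rintro f (rfl | hf) ξ
  · rw [h1, h2]
  · exact h f hf ξ

/-- The vector `Ω e_i`. -/
def bvec (i : ι) : HSum H ι := WithLp.toLp 2 (Pi.single i 𝔐.Ω)

/-- The (non-normalized) trace on matrices. -/
def tr (S : HSum H ι →L[ℂ] HSum H ι) : ℂ := ∑ i, inner ℂ (𝔐.bvec i) (S (𝔐.bvec i))

omit [DecidableEq κ] in
theorem diagL_bvec {a : H →L[ℂ] H} (i : ι) :
    diagL a (𝔐.bvec i) = WithLp.toLp 2 (Pi.single i (a 𝔐.Ω)) := by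
  ext j
  obtain rfl | h := eq_or_ne j i
  · simp [bvec]
  · rw [diagL_apply, bvec, PiLp.toLp_apply, PiLp.toLp_apply, Pi.single_eq_of_ne h,
      Pi.single_eq_of_ne h, map_zero]

theorem diagL_projL2_bvec (i : ι) : diagL (𝔐.projL2 R) (𝔐.bvec i) = 𝔐.bvec i := by
  have h : 𝔐.projL2 R 𝔐.Ω = 𝔐.Ω := by simpa using 𝔐.projL2_apply_Ω (one_mem R)
  rw [diagL_bvec, h, bvec]

omit [DecidableEq κ] in
theorem apply_bvec_mem {Z : HSum H ι →L[ℂ] HSum H κ} (hZ : Intertwines (𝔐.eqvSet R) Z)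
    (i : ι) (j : κ) : Z (𝔐.bvec i) j ∈ L2 𝔐 R := by
  rw [← 𝔐.diagL_projL2_bvec (R := R), hZ _ (Or.inl rfl)]
  exact 𝔐.projL2_mem _

/-- The matrix of the adjoint is the conjugate transpose. Entries are treated as vectors of `L²(R)`,
with `J` as the adjoint, so no commutation theorem is needed. -/
theorem adjoint_apply_bvec (hR : R ≤ 𝔐.M.toStarSubalgebra) {Z : HSum H ι →L[ℂ] HSum H κ}
    (hZ : Intertwines (𝔐.eqvSet R) Z) (i : ι) (j : κ) :
    ContinuousLinearMap.adjoint Z (𝔐.bvec j) i = 𝔐.J (Z (𝔐.bvec i) j) := by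
  have hZ' := hZ.adjoint fun f hf => 𝔐.star_mem_eqvSet hf
  refine 𝔐.eq_of_inner_L2 (𝔐.apply_bvec_mem hZ' _ _)
    (𝔐.J_mem_L2 hR (𝔐.apply_bvec_mem hZ _ _)) fun a ha => ?_
  have h1 : ∀ x ∈ R, diagL (𝔐.ractL x) (𝔐.bvec i) = WithLp.toLp 2 (Pi.single i (x 𝔐.Ω)) :=
    fun x hx => by rw [diagL_bvec, 𝔐.ractL_Ω (hR hx)]
  calc inner ℂ (ContinuousLinearMap.adjoint Z (𝔐.bvec j) i) (a 𝔐.Ω)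
      = inner ℂ (ContinuousLinearMap.adjoint Z (𝔐.bvec j))
          (WithLp.toLp 2 (Pi.single i (a 𝔐.Ω)) : HSum H ι) := by
        rw [← inner_conj_symm, ← inner_toLp_single, inner_conj_symm]
    _ = inner ℂ (𝔐.bvec j) (diagL (𝔐.ractL a) (Z (𝔐.bvec i))) := by
        rw [ContinuousLinearMap.adjoint_inner_left, ← h1 a ha, hZ _ (Or.inr ⟨a, ha, rfl⟩)]
    _ = inner ℂ 𝔐.Ω (𝔐.ractL a (Z (𝔐.bvec i) j)) := by
        rw [bvec, inner_toLp_single, diagL_apply]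
    _ = inner ℂ (𝔐.J (a 𝔐.Ω)) (Z (𝔐.bvec i) j) := by
        rw [← star_star a, ← star_ractL, ContinuousLinearMap.star_eq_adjoint (𝔐.ractL (star a)),
          ContinuousLinearMap.adjoint_inner_right, 𝔐.ractL_Ω (hR (star_mem ha)), star_star,
          𝔐.J_apply a (hR ha)]
    _ = _ := by rw [𝔐.inner_J]

/-- Both sides expand to the same double sum of `⟨J Y_ij, Z_ji⟩`, by the symmetry of `J`. -/
theorem tr_comp_comm (hR : R ≤ 𝔐.M.toStarSubalgebra) {Y : HSum H κ →L[ℂ] HSum H ι}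
    {Z : HSum H ι →L[ℂ] HSum H κ}
    (hY : Intertwines (𝔐.eqvSet R) Y) (hZ : Intertwines (𝔐.eqvSet R) Z) :
    𝔐.tr (Y ∘L Z) = 𝔐.tr (Z ∘L Y) := by
  have h1 : ∀ i, inner ℂ (𝔐.bvec i) ((Y ∘L Z) (𝔐.bvec i))
      = ∑ j, inner ℂ (𝔐.J (Y (𝔐.bvec j) i)) (Z (𝔐.bvec i) j) := fun i => by
    rw [ContinuousLinearMap.comp_apply, ← ContinuousLinearMap.adjoint_inner_left,
      PiLp.inner_apply]
    exact Finset.sum_congr rfl fun j _ => by rw [𝔐.adjoint_apply_bvec hR hY]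
  have h2 : ∀ j, inner ℂ (𝔐.bvec j) ((Z ∘L Y) (𝔐.bvec j))
      = ∑ i, inner ℂ (𝔐.J (Y (𝔐.bvec j) i)) (Z (𝔐.bvec i) j) := fun j => by
    rw [ContinuousLinearMap.comp_apply, ← ContinuousLinearMap.adjoint_inner_left,
      PiLp.inner_apply]
    exact Finset.sum_congr rfl fun i _ => by rw [𝔐.adjoint_apply_bvec hR hZ, 𝔐.inner_J]
  rw [tr, tr, Finset.sum_congr rfl fun i _ => h1 i, Finset.sum_congr rfl fun j _ => h2 j,
    Finset.sum_comm]

end TracialAlgebra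

end Amplification

end FolnerDim

namespace FolnerDim

/-! ### Comparison of dimensions by ergodic averages. -/

section Comparison

section Abstract

variable {K : Type*} [NormedAddCommGroup K] [InnerProductSpace ℂ K] [CompleteSpace K]

/-- By the mean ergodic theorem the averages of the powers of `f` converge strongly to the
projection onto its fixed vectors, so a bound uniform in `j` passes to the limit. -/
theorem sum_re_inner_sub_starProjection_le {ι : Type*} [Fintype ι] (b : ι → K) {f : K →L[ℂ] K}
    (hf : ‖f‖ ≤ 1) {c : ℝ} (h : ∀ j : ℕ, ∑ i, (inner ℂ (b i) (b i - (f ^ j) (b i))).re ≤ c) :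
    ∑ i, (inner ℂ (b i) (b i - (f.eqLocus (1 : K →L[ℂ] K)).starProjection (b i))).re ≤ c := by
  have hlim : Tendsto (fun n : ℕ => ∑ i, (inner ℂ (b i) (b i -
      birkhoffAverage ℂ f _root_.id n (b i))).re) atTop (𝓝 (∑ i, (inner ℂ (b i) (b i -
        (f.eqLocus (1 : K →L[ℂ] K)).starProjection (b i))).re)) := by
    refine tendsto_finsetSum _ fun i _ => ?_
    have h1 := f.tendsto_birkhoffAverage_orthogonalProjection hf (b i)
    exact (Complex.continuous_re.tendsto _).comp
      (Tendsto.inner tendsto_const_nhds (tendsto_const_nhds.sub h1))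
  refine le_of_tendsto hlim ((eventually_ge_atTop 1).mono fun n hn => ?_)
  have hn0 : (n : ℂ) ≠ 0 := by exact_mod_cast (by omega : n ≠ 0)
  have hn0' : (n : ℝ) ≠ 0 := by exact_mod_cast (by omega : n ≠ 0)
  have e1 : ∀ i, (inner ℂ (b i) (b i - birkhoffAverage ℂ f _root_.id n (b i))).re
      = (n : ℝ)⁻¹ * ∑ j ∈ Finset.range n, (inner ℂ (b i) (b i - (f ^ j) (b i))).re := fun i => by
    have : b i - birkhoffAverage ℂ f _root_.id n (b i)
        = ((n : ℝ)⁻¹ : ℂ) • ∑ j ∈ Finset.range n, (b i - (f ^ j) (b i)) := by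
      rw [Finset.sum_sub_distrib, smul_sub, Finset.sum_const, Finset.card_range,
        birkhoffAverage, birkhoffSum, ← Nat.cast_smul_eq_nsmul ℂ, smul_smul]
      simp [hn0]
    rw [this, inner_smul_right, inner_sum, ← Complex.ofReal_inv, Complex.re_ofReal_mul,
      Complex.re_sum]
  simp only [e1]
  rw [← Finset.mul_sum, Finset.sum_comm]
  calc (n : ℝ)⁻¹ * ∑ j ∈ Finset.range n, ∑ i, (inner ℂ (b i) (b i - (f ^ j) (b i))).re
      ≤ (n : ℝ)⁻¹ * ∑ _j ∈ Finset.range n, c := by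
        gcongr with j _
        exact h j
    _ = c := by
      rw [Finset.sum_const, Finset.card_range, nsmul_eq_mul, inv_mul_cancel_left₀ hn0']

/-- `C = (1 - B)^j` is positive and acts as the identity on the complement of `l`, so `C - (1 - l) =
l C l ≥ 0`. -/
theorem one_sub_pow_one_sub_le {B l : K →L[ℂ] K} (hl : IsStarProjection l) (hB : 0 ≤ 1 - B)
    (hBl : B * l = B) (j : ℕ) : 1 - (1 - B) ^ j ≤ l := by
  have hll : l * l = l := hl.isIdempotentElem
  set C := (1 - B) ^ j with hC
  have hC0 : 0 ≤ C := CStarAlgebra.pow_nonneg hB j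
  have h1 : C * (1 - l) = 1 - l := by
    rw [hC]
    induction j with
    | zero => rw [pow_zero, one_mul]
    | succ n ih =>
      have : (1 - B) * (1 - l) = 1 - l := by
        rw [sub_mul, one_mul, mul_sub, hBl, mul_one, sub_self, sub_zero]
      rw [pow_succ, mul_assoc, this]
      exact ih rfl (CStarAlgebra.pow_nonneg hB n)
  have h2 : (1 - l) * C = 1 - l := by
    have hs := congrArg star h1
    rwa [star_mul, hC0.isSelfAdjoint, hl.one_sub.isSelfAdjoint] at hs
  have h3 : l * C * l = C - (1 - l) := by
    have e1 : C * l = C - (1 - l) := by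
      rw [mul_sub, mul_one] at h1
      rw [← h1]; abel
    have e2 : l * C = C - (1 - l) := by
      rw [sub_mul, one_mul] at h2
      rw [← h2]; abel
    rw [mul_assoc, e1, mul_sub, e2, mul_sub, mul_one, hll, sub_self, sub_zero]
  have h4 : 0 ≤ l * C * l := hl.isSelfAdjoint.conjugate_nonneg hC0
  rw [h3] at h4
  rw [← sub_nonneg]
  convert h4 using 1
  abel

theorem norm_one_sub_le_one {A : K →L[ℂ] K} (h0 : 0 ≤ A) (h1 : ‖A‖ ≤ 1) :
    0 ≤ 1 - A ∧ ‖1 - A‖ ≤ 1 := by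
  have h2 : A ≤ 1 := (CStarAlgebra.norm_le_one_iff_of_nonneg A h0).1 h1
  have h3 : 0 ≤ 1 - A := sub_nonneg.2 h2
  exact ⟨h3, (CStarAlgebra.norm_le_one_iff_of_nonneg _ h3).2 (sub_le_self _ h0)⟩

end Abstract

namespace TracialAlgebra

variable {H : Type*} [NormedAddCommGroup H] [InnerProductSpace ℂ H] [CompleteSpace H]
variable (𝔐 : TracialAlgebra H) {R : StarSubalgebra ℂ (H →L[ℂ] H)}
variable {ι κ : Type*} [Fintype ι] [Fintype κ] [DecidableEq ι] [DecidableEq κ]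

theorem tr_add (S S' : HSum H ι →L[ℂ] HSum H ι) : 𝔐.tr (S + S') = 𝔐.tr S + 𝔐.tr S' := by
  simp [tr, Finset.sum_add_distrib]

theorem tr_sub (S S' : HSum H ι →L[ℂ] HSum H ι) : 𝔐.tr (S - S') = 𝔐.tr S - 𝔐.tr S' := by
  simp [tr, Finset.sum_sub_distrib]

theorem tr_sum {α : Type*} (s : Finset α) (S : α → HSum H ι →L[ℂ] HSum H ι) :
    𝔐.tr (∑ a ∈ s, S a) = ∑ a ∈ s, 𝔐.tr (S a) := by
  simp only [tr, sum_apply, inner_sum]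
  exact Finset.sum_comm

theorem re_tr_mono {S S' : HSum H ι →L[ℂ] HSum H ι} (h : S ≤ S') :
    (𝔐.tr S).re ≤ (𝔐.tr S').re := by
  rw [tr, tr, Complex.re_sum, Complex.re_sum]
  refine Finset.sum_le_sum fun i _ => ?_
  have := ((ContinuousLinearMap.le_def _ _).1 h).re_inner_nonneg_right (𝔐.bvec i)
  rw [sub_apply, inner_sub_right, map_sub, sub_nonneg] at this
  exact this

/-- Each increment in `j` has the form `Y Z` on one side and `Z Y` on the other, with `Y = (1 - Z*
Z)^n Z*`, since `Z (1 - Z* Z)^n = (1 - Z Z*)^n Z`. -/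
theorem tr_one_sub_pow (hR : R ≤ 𝔐.M.toStarSubalgebra) {Z : HSum H ι →L[ℂ] HSum H κ}
    (hZ : Intertwines (𝔐.eqvSet R) Z) (j : ℕ) :
    𝔐.tr (1 - (1 - ContinuousLinearMap.adjoint Z ∘L Z) ^ j)
      = 𝔐.tr (1 - (1 - Z ∘L ContinuousLinearMap.adjoint Z) ^ j) := by
  set Z' := ContinuousLinearMap.adjoint Z with hZ'
  have hZ'i : Intertwines (𝔐.eqvSet R) Z' := hZ.adjoint fun f hf => 𝔐.star_mem_eqvSet hf
  have hA : Intertwines (𝔐.eqvSet R) (1 - Z' ∘L Z) := Intertwines.one.sub (hZ'i.comp hZ)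
  have comm : ∀ j, Z ∘L (1 - Z' ∘L Z) ^ j = ((1 - Z ∘L Z') ^ j) ∘L Z := by
    intro j
    induction j with
    | zero => rfl
    | succ n ih =>
      ext1 ξ
      have := DFunLike.congr_fun ih ((1 - Z' ∘L Z) ξ)
      simp only [ContinuousLinearMap.comp_apply] at this
      simp only [pow_succ, ContinuousLinearMap.comp_apply, mul_apply_eq_comp, this]
      congr 1
      simp
  induction j with
  | zero => simp [tr]
  | succ n ih =>
    have e1 : 1 - (1 - Z' ∘L Z) ^ (n + 1)
        = (1 - (1 - Z' ∘L Z) ^ n) + (((1 - Z' ∘L Z) ^ n) ∘L Z') ∘L Z := by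
      rw [pow_succ, mul_sub, mul_one]
      change _ = 1 - (1 - Z' ∘L Z) ^ n + (1 - Z' ∘L Z) ^ n * (Z' ∘L Z)
      abel
    have e2 : 1 - (1 - Z ∘L Z') ^ (n + 1)
        = (1 - (1 - Z ∘L Z') ^ n) + Z ∘L (((1 - Z' ∘L Z) ^ n) ∘L Z') := by
      rw [pow_succ, mul_sub, mul_one, ← ContinuousLinearMap.comp_assoc, comm]
      change _ = 1 - (1 - Z ∘L Z') ^ n + (1 - Z ∘L Z') ^ n * (Z ∘L Z')
      abel
    rw [e1, e2, tr_add, tr_add, ih, 𝔐.tr_comp_comm hR ((hA.pow n).comp hZ'i) hZ]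

/-- The traces of `1 - (1 - Z* Z)^j` and `1 - (1 - Z Z*)^j` agree, and the second is at most that of
`l`. Averaging over `j` turns the first into the trace of the projection onto the complement of `ker
Z`, which dominates `d`. -/
theorem re_tr_le_of_norm_le_one (hR : R ≤ 𝔐.M.toStarSubalgebra) {Z : HSum H ι →L[ℂ] HSum H κ}
    (hZ : Intertwines (𝔐.eqvSet R) Z) (hZ1 : ‖Z‖ ≤ 1) {d : HSum H ι →L[ℂ] HSum H ι}
    {l : HSum H κ →L[ℂ] HSum H κ} (hd : IsStarProjection d) (hl : IsStarProjection l)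
    (hker : ∀ ξ, Z ξ = 0 → d ξ = 0) (hlZ : ∀ ξ, l (Z ξ) = Z ξ) :
    (𝔐.tr d).re ≤ (𝔐.tr l).re := by
  set Z' := ContinuousLinearMap.adjoint Z with hZ'
  have hn : ‖Z'‖ ≤ 1 := by rwa [hZ', LinearIsometryEquiv.norm_map]
  have hA := norm_one_sub_le_one (A := Z' ∘L Z)
    ((ContinuousLinearMap.nonneg_iff_isPositive _).2
      (ContinuousLinearMap.isPositive_adjoint_comp_self Z))
    ((ContinuousLinearMap.opNorm_comp_le _ _).trans (mul_le_one₀ hn (norm_nonneg _) hZ1))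
  have hB := norm_one_sub_le_one (A := Z ∘L Z')
    ((ContinuousLinearMap.nonneg_iff_isPositive _).2
      (ContinuousLinearMap.isPositive_self_comp_adjoint Z))
    ((ContinuousLinearMap.opNorm_comp_le _ _).trans (mul_le_one₀ hZ1 (norm_nonneg _) hn))
  have hlB : l * (Z ∘L Z') = Z ∘L Z' := by ext1 ξ; exact hlZ _
  have hBl : (Z ∘L Z') * l = Z ∘L Z' := by
    have hs := congrArg star hlB
    have hsB : star (Z ∘L Z') = Z ∘L Z' :=
      (ContinuousLinearMap.isPositive_self_comp_adjoint Z).isSelfAdjoint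
    rwa [star_mul, hsB, hl.isSelfAdjoint] at hs
  have key := sum_re_inner_sub_starProjection_le (𝔐.bvec : ι → HSum H ι) hA.2 (c := (𝔐.tr l).re)
    fun j => by
      have h := 𝔐.re_tr_mono (one_sub_pow_one_sub_le hl hB.1 hBl j)
      rw [← 𝔐.tr_one_sub_pow hR hZ j, tr, Complex.re_sum] at h
      exact h
  refine le_trans ?_ key
  rw [tr, Complex.re_sum]
  refine Finset.sum_le_sum fun i _ => ?_
  set F := (1 - Z' ∘L Z).eqLocus (1 : HSum H ι →L[ℂ] HSum H ι) with hF
  -- The fixed vectors of `1 - Z* Z` form the kernel of `Z`, where `d` vanishes.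
  have hFZ : ∀ ξ ∈ F, d ξ = 0 := fun ξ hξ => by
    refine hker ξ ?_
    have h1 : Z' (Z ξ) = 0 := by
      have : ξ - Z' (Z ξ) = ξ := hξ
      simpa using this
    have h2 : inner ℂ (Z ξ) (Z ξ) = (0 : ℂ) := by
      rw [← ContinuousLinearMap.adjoint_inner_right, ← hZ', h1, inner_zero_right]
    exact inner_self_eq_zero.1 h2
  have h1 := re_inner_isStarProjection hd (𝔐.bvec i)
  have h2 := re_inner_isStarProjection (isStarProjection_starProjection F).one_sub (𝔐.bvec i)
  have h3 : d (𝔐.bvec i) = d ((1 - F.starProjection) (𝔐.bvec i)) := by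
    rw [sub_apply, map_sub, hFZ _ (F.starProjection_apply_mem _), sub_zero]
    rfl
  have h4 : ‖d ((1 - F.starProjection) (𝔐.bvec i))‖ ≤ ‖(1 - F.starProjection) (𝔐.bvec i)‖ :=
    (d.le_opNorm _).trans (mul_le_of_le_one_left (norm_nonneg _) (hd.norm_le _))
  change _ ≤ (inner ℂ (𝔐.bvec i) ((1 - F.starProjection) (𝔐.bvec i))).re
  rw [h1, h2, h3]
  gcongr

/-- Comparison of dimensions: if an equivariant operator `Z` is injective on the range of `d` and
has its range in that of `l`, then `d` has trace at most that of `l`. -/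
theorem re_tr_le_of_injective (hR : R ≤ 𝔐.M.toStarSubalgebra) {Z : HSum H ι →L[ℂ] HSum H κ}
    (hZ : Intertwines (𝔐.eqvSet R) Z) {d : HSum H ι →L[ℂ] HSum H ι}
    {l : HSum H κ →L[ℂ] HSum H κ} (hd : IsStarProjection d) (hl : IsStarProjection l)
    (hker : ∀ ξ, Z ξ = 0 → d ξ = 0) (hlZ : ∀ ξ, l (Z ξ) = Z ξ) :
    (𝔐.tr d).re ≤ (𝔐.tr l).re := by
  -- Rescaling makes `Z` a contraction; the summand `1` covers `Z = 0`.
  have hpos : 0 < ‖Z‖ + 1 := by positivity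
  have hc : (((‖Z‖ + 1 : ℝ) : ℂ)⁻¹) ≠ 0 := inv_ne_zero (Complex.ofReal_ne_zero.2 hpos.ne')
  refine 𝔐.re_tr_le_of_norm_le_one hR (hZ.smul (((‖Z‖ + 1 : ℝ) : ℂ)⁻¹)) ?_ hd hl
    (fun ξ hξ => hker ξ ?_) fun ξ => ?_
  · refine (ContinuousLinearMap.opNorm_smul_le _ _).trans ?_
    rw [norm_inv, Complex.norm_real, Real.norm_of_nonneg hpos.le, inv_mul_le_one₀ hpos]
    linarith
  · exact (smul_eq_zero.1 hξ).resolve_left hc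
  · rw [smul_apply, map_smul, hlZ]

end TracialAlgebra

end Comparison

end FolnerDim

namespace FolnerDim

/-! ### Normal embeddings and the trace on amplifications. -/

section Embeddings

variable {H : Type*} [NormedAddCommGroup H] [InnerProductSpace ℂ H] [CompleteSpace H]
variable (𝔐 : TracialAlgebra H) {R : StarSubalgebra ℂ (H →L[ℂ] H)}

section General

variable {K : Type*} [NormedAddCommGroup K] [InnerProductSpace ℂ K] [CompleteSpace K]
variable {F : Submodule ℂ K} [CompleteSpace F] {m : ℕ}

/-- The partial isometry on the whole space extending an isometry on the subspace `F`. -/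
def partialIso (V : F →ₗᵢ[ℂ] Amp H m) : K →L[ℂ] Amp H m :=
  V.toContinuousLinearMap ∘L F.orthogonalProjectionOnto

theorem partialIso_apply (V : F →ₗᵢ[ℂ] Amp H m) (ξ : K) :
    partialIso V ξ = V (F.orthogonalProjectionOnto ξ) := rfl

theorem adjoint_partialIso (V : F →ₗᵢ[ℂ] Amp H m) :
    ContinuousLinearMap.adjoint (partialIso V)
      = F.subtypeL ∘L ContinuousLinearMap.adjoint V.toContinuousLinearMap := by
  rw [partialIso, ContinuousLinearMap.adjoint_comp, Submodule.adjoint_orthogonalProjectionOnto]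

theorem adjoint_partialIso_mem (V : F →ₗᵢ[ℂ] Amp H m) (η : Amp H m) :
    ContinuousLinearMap.adjoint (partialIso V) η ∈ F := by
  rw [adjoint_partialIso]
  exact Subtype.property _

theorem adjoint_partialIso_apply (V : F →ₗᵢ[ℂ] Amp H m) (ξ : K) :
    ContinuousLinearMap.adjoint (partialIso V) (partialIso V ξ) = F.starProjection ξ := by
  have h : ∀ ζ : F, ContinuousLinearMap.adjoint V.toContinuousLinearMap (V ζ) = ζ := fun ζ =>
    ext_inner_right ℂ fun η => by
      rw [ContinuousLinearMap.adjoint_inner_left]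
      exact V.inner_map_map ζ η
  rw [adjoint_partialIso, partialIso_apply, ContinuousLinearMap.comp_apply, h]
  rfl

theorem partialIso_starProjection (V : F →ₗᵢ[ℂ] Amp H m) (ξ : K) :
    partialIso V (F.starProjection ξ) = partialIso V ξ := by
  rw [partialIso_apply, partialIso_apply, Submodule.starProjection_apply,
    Submodule.orthogonalProjectionOnto_mem_subspace_eq_self]

theorem partialIso_eq_zero (V : F →ₗᵢ[ℂ] Amp H m) {ξ : K} (hξ : ξ ∈ F) (h : partialIso V ξ = 0) :
    ξ = 0 := by
  rw [← Submodule.starProjection_eq_self_iff.2 hξ, ← adjoint_partialIso_apply V, h, map_zero]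

variable {act : (H →L[ℂ] H) → K → K}

section NormalEmbedding

variable {𝔐} {V : F →ₗᵢ[ℂ] Amp H m} (hV : IsNormalEmbedding 𝔐 R act F V)
include hV

theorem diagL_partialIso (ξ : K) : diagL (𝔐.projL2 R) (partialIso V ξ) = partialIso V ξ := by
  ext i
  exact 𝔐.projL2_of_mem (hV.1 _ i)

theorem adjoint_partialIso_diagL (η : Amp H m) :
    ContinuousLinearMap.adjoint (partialIso V) (diagL (𝔐.projL2 R) η)
      = ContinuousLinearMap.adjoint (partialIso V) η := by
  refine ext_inner_right ℂ fun ξ => ?_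
  rw [ContinuousLinearMap.adjoint_inner_left, inner_diagL_left, 𝔐.star_projL2,
    diagL_partialIso hV, ContinuousLinearMap.adjoint_inner_left]

theorem partialIso_act {A : (H →L[ℂ] H) → K →L[ℂ] K} (hA : ∀ a ξ, act a ξ = A a ξ)
    (hstar : ∀ a, star (A a) = A (star a)) (hF : ∀ a ∈ R, ∀ ξ ∈ F, A a ξ ∈ F)
    {a : H →L[ℂ] H} (ha : a ∈ R) (ξ : K) :
    partialIso V (A a ξ) = diagL (𝔐.ractL a) (partialIso V ξ) := by
  refine hV.2 a ha _ _ ?_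
  have := starProjection_comm (hF a ha)
    (fun ζ hζ => by rw [hstar]; exact hF _ (star_mem ha) ζ hζ) ξ
  rw [hA]
  exact this.symm

end NormalEmbedding

/-- One embedding serves all `S` at once, so traces of different operators can be compared through
the same `V`. -/
theorem exists_normalTrace_eq
    (h : ∃ m : ℕ, ∃ V : F →ₗᵢ[ℂ] Amp H m, IsNormalEmbedding 𝔐 R act F V) :
    ∃ m : ℕ, ∃ V : F →ₗᵢ[ℂ] Amp H m, IsNormalEmbedding 𝔐 R act F V ∧ ∀ S : K →L[ℂ] K,
      normalTrace 𝔐 R act F (compress F S)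
        = 𝔐.tr (partialIso V ∘L S ∘L ContinuousLinearMap.adjoint (partialIso V)) := by
  refine ⟨h.choose, h.choose_spec.choose, h.choose_spec.choose_spec, fun S => ?_⟩
  rw [normalTrace, dif_pos h, adjoint_partialIso]
  rfl

theorem normalDim_eq (F : Submodule ℂ K) [CompleteSpace F] :
    normalDim 𝔐 R act F = (normalTrace 𝔐 R act F (compress F 1)).re := by
  rw [normalDim]
  congr 2
  ext1 ξ
  exact (Submodule.orthogonalProjectionOnto_mem_subspace_eq_self ξ).symm

end General

variable {F : Submodule ℂ H} [CompleteSpace F] {k m : ℕ}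

instance : CompleteSpace (ampSubspace F k) :=
  (isClosed_ampSubspace _ (by
    have := (completeSpace_coe_iff_isComplete (s := (F : Set H))).1 inferInstance
    exact this.isClosed) k).completeSpace_coe

theorem starProjection_ampSubspace_apply (ξ : Amp H k) (i : Fin k) :
    (ampSubspace F k).starProjection ξ i = F.starProjection (ξ i) := by
  have : (ampSubspace F k).starProjection ξ = WithLp.toLp 2 fun i => F.starProjection (ξ i) := by
    refine Submodule.eq_starProjection_of_mem_of_inner_eq_zero
      (fun i => F.starProjection_apply_mem _) fun w hw => ?_
    rw [PiLp.inner_apply]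
    exact Finset.sum_eq_zero fun i _ => F.starProjection_inner_eq_zero _ _ (hw i)
  rw [this]

/-- The amplification of an isometric embedding. -/
def ampIso (V : F →ₗᵢ[ℂ] Amp H m) (k : ℕ) : ampSubspace F k →ₗᵢ[ℂ] Amp H (k * m) where
  toFun ξ := WithLp.toLp 2 fun j =>
    V ⟨(ξ : Amp H k) (finProdFinEquiv.symm j).1, ξ.2 _⟩ (finProdFinEquiv.symm j).2
  map_add' ξ η := by
    ext j
    exact congrArg (fun v : Amp H m => v (finProdFinEquiv.symm j).2) (V.map_add
      ⟨(ξ : Amp H k) (finProdFinEquiv.symm j).1, ξ.2 _⟩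
      ⟨(η : Amp H k) (finProdFinEquiv.symm j).1, η.2 _⟩)
  map_smul' c ξ := by
    ext j
    exact congrArg (fun v : Amp H m => v (finProdFinEquiv.symm j).2) (V.map_smul c
      ⟨(ξ : Amp H k) (finProdFinEquiv.symm j).1, ξ.2 _⟩)
  norm_map' ξ := by
    rw [← sq_eq_sq₀ (norm_nonneg _) (norm_nonneg _), PiLp.norm_sq_eq_of_L2, Submodule.coe_norm,
      PiLp.norm_sq_eq_of_L2]
    change ∑ j, ‖V ⟨(ξ : Amp H k) (finProdFinEquiv.symm j).1, ξ.2 _⟩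
      (finProdFinEquiv.symm j).2‖ ^ 2 = _
    rw [finProdFinEquiv.symm.sum_comp (fun p : Fin k × Fin m =>
      ‖V ⟨(ξ : Amp H k) p.1, ξ.2 _⟩ p.2‖ ^ 2), Fintype.sum_prod_type]
    refine Finset.sum_congr rfl fun i _ => ?_
    exact (PiLp.norm_sq_eq_of_L2 _ (V ⟨(ξ : Amp H k) i, ξ.2 i⟩)).symm.trans
      (by rw [V.norm_map]; rfl)

theorem isNormalEmbedding_ampIso {V : F →ₗᵢ[ℂ] Amp H m}
    (hV : IsNormalEmbedding 𝔐 R 𝔐.ract F V) (k : ℕ) :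
    IsNormalEmbedding 𝔐 R (ampAct 𝔐) (ampSubspace F k) (ampIso V k) := by
  refine ⟨fun ξ j => hV.1 _ _, fun a ha ξ η h => ?_⟩
  ext j
  refine congrArg (fun v : Amp H m => v (finProdFinEquiv.symm j).2) (hV.2 a ha
      ⟨(ξ : Amp H k) (finProdFinEquiv.symm j).1, ξ.2 _⟩
      ⟨(η : Amp H k) (finProdFinEquiv.symm j).1, η.2 _⟩ ?_)
  exact congrArg (fun v : Amp H k => v (finProdFinEquiv.symm j).1) h

theorem ampSubspace_invariant (hF : ∀ a ∈ R, ∀ ξ ∈ F, 𝔐.ractL a ξ ∈ F) (a : H →L[ℂ] H)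
    (ha : a ∈ R) (ξ : Amp H k) (hξ : ξ ∈ ampSubspace F k) :
    diagL (𝔐.ractL a) ξ ∈ ampSubspace F k := fun i => hF a ha _ (hξ i)

theorem intertwines_partialIso (hF : ∀ a ∈ R, ∀ ξ ∈ F, 𝔐.ractL a ξ ∈ F)
    {W : ampSubspace F k →ₗᵢ[ℂ] Amp H m}
    (hW : IsNormalEmbedding 𝔐 R (ampAct 𝔐) (ampSubspace F k) W) :
    Intertwines (𝔐.ractSet R) (partialIso W) := by
  rintro _ ⟨a, ha, rfl⟩ ξ
  exact partialIso_act hW (A := fun a => diagL (𝔐.ractL a)) (fun _ _ => rfl)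
    (fun a => by rw [star_diagL, 𝔐.star_ractL]) (ampSubspace_invariant 𝔐 hF) ha ξ

/-- The trace on the amplification `F^k` is the sum of the traces of the diagonal entries. -/
theorem tr_partialIso_amp (hR : R ≤ 𝔐.M.toStarSubalgebra)
    (hF : ∀ a ∈ R, ∀ ξ ∈ F, 𝔐.ractL a ξ ∈ F) {m' : ℕ} {V : F →ₗᵢ[ℂ] Amp H m}
    (hV : IsNormalEmbedding 𝔐 R 𝔐.ract F V) {W : ampSubspace F k →ₗᵢ[ℂ] Amp H m'}
    (hW : IsNormalEmbedding 𝔐 R (ampAct 𝔐) (ampSubspace F k) W)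
    {S : Amp H k →L[ℂ] Amp H k} (hS : Intertwines (𝔐.ractSet R) S) :
    𝔐.tr (partialIso W ∘L S ∘L ContinuousLinearMap.adjoint (partialIso W))
      = ∑ i, 𝔐.tr (partialIso V ∘L (coord i ∘L S ∘L ContinuousLinearMap.adjoint (coord i)) ∘L
        ContinuousLinearMap.adjoint (partialIso V)) := by
  have hWi := intertwines_partialIso 𝔐 hF hW
  have hsr : ∀ f ∈ 𝔐.ractSet R, star f ∈ 𝔐.ractSet R := fun f hf => 𝔐.star_mem_ractSet hf
  -- `V` and `W` come from unrelated choices. The operators `U i` satisfy `∑ U_i* U_i = P_{F^k}`;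
  -- inserting this sum after `W` and using the trace property on each term replaces `W` by `V`.
  set U : Fin k → Amp H k →L[ℂ] Amp H m := fun i => partialIso V ∘L coord i with hU
  have hUi : ∀ i, Intertwines (𝔐.ractSet R) (U i) := by
    rintro i _ ⟨a, ha, rfl⟩ ξ
    exact partialIso_act hV (A := fun a => 𝔐.ractL a) (fun _ _ => rfl)
      (fun a => 𝔐.star_ractL a) hF ha (ξ i)
  have hUadj : ∀ i, ContinuousLinearMap.adjoint (U i)
      = ContinuousLinearMap.adjoint (coord i) ∘L ContinuousLinearMap.adjoint (partialIso V) :=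
    fun i => ContinuousLinearMap.adjoint_comp _ _
  have hsum : ∀ ξ, ∑ i, ContinuousLinearMap.adjoint (U i) (U i ξ)
      = (ampSubspace F k).starProjection ξ := fun ξ => by
    rw [← sum_adjoint_coord_comp ((ampSubspace F k).starProjection ξ)]
    refine Finset.sum_congr rfl fun i _ => ?_
    rw [hUadj, starProjection_ampSubspace_apply]
    simp only [hU, ContinuousLinearMap.comp_apply, adjoint_partialIso_apply, coord_apply]
  have hUmem : ∀ i η, ContinuousLinearMap.adjoint (U i) η ∈ ampSubspace F k := fun i η j => by
    rw [hUadj, ContinuousLinearMap.comp_apply, adjoint_coord_apply]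
    obtain rfl | hj := eq_or_ne j i
    · rw [PiLp.toLp_apply, Pi.single_eq_same]
      exact adjoint_partialIso_mem V η
    · rw [PiLp.toLp_apply, Pi.single_eq_of_ne hj]
      exact F.zero_mem
  have e1 : partialIso W ∘L S ∘L ContinuousLinearMap.adjoint (partialIso W)
      = ∑ i, (partialIso W ∘L ContinuousLinearMap.adjoint (U i)) ∘L
        (U i ∘L S ∘L ContinuousLinearMap.adjoint (partialIso W)) := by
    ext1 η
    rw [sum_apply]
    simp only [ContinuousLinearMap.comp_apply]
    rw [← map_sum, hsum, partialIso_starProjection]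
  have hUe : ∀ i ξ, diagL (𝔐.projL2 R) (U i ξ) = U i ξ := fun i ξ => diagL_partialIso hV _
  have hUe' : ∀ i η, ContinuousLinearMap.adjoint (U i) (diagL (𝔐.projL2 R) η)
      = ContinuousLinearMap.adjoint (U i) η := fun i η => by
    rw [hUadj, ContinuousLinearMap.comp_apply, adjoint_partialIso_diagL hV]
    rfl
  rw [e1, 𝔐.tr_sum]
  refine Finset.sum_congr rfl fun i _ => ?_
  rw [𝔐.tr_comp_comm hR]
  · congr 1
    ext1 η
    simp only [ContinuousLinearMap.comp_apply]
    rw [adjoint_partialIso_apply, Submodule.starProjection_eq_self_iff.2 (hUmem i η), hUadj]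
    rfl
  · exact 𝔐.intertwines_eqvSet (hWi.comp ((hUi i).adjoint hsr))
      (fun _ => diagL_partialIso hW _) fun ξ => by
        simp only [ContinuousLinearMap.comp_apply, hUe']
  · exact 𝔐.intertwines_eqvSet ((hUi i).comp (hS.comp (hWi.adjoint hsr)))
      (fun _ => hUe _ _) fun ξ => by
        simp only [ContinuousLinearMap.comp_apply, adjoint_partialIso_diagL hW]

end Embeddings

end FolnerDim

namespace FolnerDim

/-! ### Rows presenting projective submodules; equivariant kernels. -/

section Rows

variable {H : Type*} [NormedAddCommGroup H] [InnerProductSpace ℂ H] [CompleteSpace H]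

/-- The `x j` are the images of the unit vectors under `R^m → p R^m ≅ Q ⊆ S`. Since the last two
maps are injective, only the kernel of `p` is lost. -/
theorem exists_row {R : StarSubalgebra ℂ (H →L[ℂ] H)} {S : Submodule (↥R)ᵐᵒᵖ (H →L[ℂ] H)}
    {Q : Submodule (↥R)ᵐᵒᵖ S} {m : ℕ} {p : Matrix (Fin m) (Fin m) R}
    (φ : Q ≃ₗ[(↥R)ᵐᵒᵖ] matrixModule p) :
    ∃ x : Fin m → (H →L[ℂ] H), (∀ v : Fin m → R, ∑ j, x j * (v j : H →L[ℂ] H) ∈ S) ∧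
      ∀ v : Fin m → R, ∑ j, x j * (v j : H →L[ℂ] H) = 0 ↔ p.mulVec v = 0 := by
  let π : (Fin m → R) →ₗ[(↥R)ᵐᵒᵖ] matrixModule p :=
    { toFun := fun v => ⟨p.mulVec v, v, rfl⟩
      map_add' := fun v w => Subtype.ext (p.mulVec_add v w)
      map_smul' := fun c v => Subtype.ext (p.mulVec_smul c v) }
  let g : (Fin m → R) →ₗ[(↥R)ᵐᵒᵖ] (H →L[ℂ] H) :=
    S.subtype ∘ₗ Q.subtype ∘ₗ φ.symm.toLinearMap ∘ₗ π
  have hg : ∀ v : Fin m → R, ∑ j, g (Pi.single j 1) * (v j : H →L[ℂ] H) = g v := fun v => by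
    have hv : v = ∑ j, MulOpposite.op (v j) • (Pi.single j 1 : Fin m → R) := by
      ext1 i
      rw [Finset.sum_apply, Finset.sum_eq_single i]
      · simp
      · intro j _ hj
        simp [Pi.single_eq_of_ne hj.symm]
      · simp
    conv_rhs => rw [hv, map_sum]
    exact Finset.sum_congr rfl fun j _ => by rw [map_smul, op_smul_eq]
  refine ⟨fun j => g (Pi.single j 1), fun v => ?_, fun v => ?_⟩
  · rw [hg]
    exact Subtype.property _
  · rw [hg]
    constructor
    · intro h
      have h1 : φ.symm (π v) = 0 := Subtype.ext (Subtype.ext h)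
      exact congrArg Subtype.val ((LinearEquiv.map_eq_zero_iff φ.symm).1 h1)
    · intro h
      have h1 : π v = 0 := Subtype.ext h
      have h2 : φ.symm (π v) = 0 := by
        rw [h1]
        exact LinearEquiv.map_zero φ.symm
      exact congrArg (fun q : Q => ((q : S) : H →L[ℂ] H)) h2

variable {m : ℕ}

/-- The amplification of the row `(x_1, …, x_m)`, as an operator from `H^(k × m)` to `H^k`. -/
def rowAmp (k : ℕ) (x : Fin m → (H →L[ℂ] H)) : HSum H (Fin k × Fin m) →L[ℂ] Amp H k :=
  matL (Matrix.of fun i l => if l.1 = i then x l.2 else 0)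

theorem rowAmp_apply {k : ℕ} (x : Fin m → (H →L[ℂ] H)) (ξ : HSum H (Fin k × Fin m)) (i : Fin k) :
    rowAmp k x ξ i = ∑ j, x j (ξ (i, j)) := by
  rw [rowAmp, matL_apply, Fintype.sum_prod_type, Finset.sum_eq_single i]
  · simp
  · intro i' _ hi'
    simp [hi']
  · simp

namespace TracialAlgebra

variable (𝔐 : TracialAlgebra H) {R : StarSubalgebra ℂ (H →L[ℂ] H)}
variable {ι κ : Type*} [Fintype ι] [Fintype κ] [DecidableEq ι] [DecidableEq κ]

theorem intertwines_matL (hR : R ≤ 𝔐.M.toStarSubalgebra) {T : Matrix κ ι (H →L[ℂ] H)}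
    (hT : ∀ i j, T i j ∈ 𝔐.M) : Intertwines (𝔐.ractSet R) (matL T) := by
  rintro _ ⟨a, ha, rfl⟩ ξ
  ext i
  rw [matL_apply, diagL_apply, matL_apply, map_sum]
  exact Finset.sum_congr rfl fun j _ => (𝔐.ractL_commute (hR ha) (hT i j) _).symm

theorem diagL_projL2_idem (ξ : HSum H ι) :
    diagL (𝔐.projL2 R) (diagL (𝔐.projL2 R) ξ) = diagL (𝔐.projL2 R) ξ := by
  ext i
  exact 𝔐.projL2_of_mem (𝔐.projL2_mem _)

/-- Right translates of the basis vectors span `L²(R)^ι` densely, so a closed subspace need only be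
tested on them. -/
theorem diagL_projL2_mem (hR : R ≤ 𝔐.M.toStarSubalgebra) {C : Submodule ℂ (HSum H ι)}
    (hC : IsClosed (C : Set (HSum H ι)))
    (h : ∀ a ∈ R, ∀ l, diagL (𝔐.ractL a) (𝔐.bvec l) ∈ C) (ξ : HSum H ι) :
    diagL (𝔐.projL2 R) ξ ∈ C := by
  rw [← sum_adjoint_coord_comp (diagL (𝔐.projL2 R) ξ)]
  refine C.sum_mem fun l _ => ?_
  refine 𝔐.L2_induction (R := R)
    (p := fun η => ContinuousLinearMap.adjoint (coord l : HSum H ι →L[ℂ] H) η ∈ C)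
    (hC.preimage (ContinuousLinearMap.continuous _)) (fun a ha => ?_) (𝔐.projL2_mem (ξ l))
  rw [adjoint_coord_apply, ← 𝔐.ractL_Ω (hR ha), ← diagL_bvec]
  exact h a ha l

theorem intertwines_starProjection_ker {Y : HSum H ι →L[ℂ] HSum H κ}
    (hY : Intertwines (𝔐.ractSet R) Y) (hYe : ∀ ξ, Y (diagL (𝔐.projL2 R) ξ) = Y ξ) :
    Intertwines (𝔐.eqvSet R) Y.ker.starProjection := by
  refine Intertwines.starProjection (fun f hf => 𝔐.star_mem_eqvSet hf) _ ?_
  rintro f (rfl | hf) ξ hξ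
  · rw [LinearMap.mem_ker, ContinuousLinearMap.coe_coe] at hξ ⊢
    rw [hYe, hξ]
  · rw [LinearMap.mem_ker, ContinuousLinearMap.coe_coe] at hξ ⊢
    rw [hY f hf, hξ, map_zero]

/-- The entries of an equivariant operator on `L²(N)^ι` belong to `N`. -/
theorem exists_coeff {N : VonNeumannAlgebra H} (hN : N.toStarSubalgebra ≤ 𝔐.M.toStarSubalgebra)
    {Y : HSum H ι →L[ℂ] HSum H κ} (hY : Intertwines (𝔐.eqvSet N.toStarSubalgebra) Y) (l : ι) :
    ∃ n : κ → N.toStarSubalgebra, ∀ i, Y (𝔐.bvec l) i = (n i : H →L[ℂ] H) 𝔐.Ω := by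
  have main : ∀ i, ∃ n ∈ N, n 𝔐.Ω = Y (𝔐.bvec l) i := fun i => by
    set y : H →L[ℂ] H := coord i ∘L Y ∘L ContinuousLinearMap.adjoint (coord l) with hy
    have hyf : ∀ f ∈ 𝔐.eqvSet N.toStarSubalgebra, ∀ ξ, y (f ξ) = f (y ξ) := fun f hf ξ => by
      have : ContinuousLinearMap.adjoint (coord l : HSum H ι →L[ℂ] H) (f ξ)
          = diagL f (ContinuousLinearMap.adjoint (coord l : HSum H ι →L[ℂ] H) ξ) := by
        ext j
        rw [diagL_apply, adjoint_coord_apply, adjoint_coord_apply, PiLp.toLp_apply,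
          PiLp.toLp_apply]
        obtain rfl | hj := eq_or_ne j l
        · rw [Pi.single_eq_same, Pi.single_eq_same]
        · rw [Pi.single_eq_of_ne hj, Pi.single_eq_of_ne hj, map_zero]
      rw [hy, ContinuousLinearMap.comp_apply, ContinuousLinearMap.comp_apply, this, hY f hf]
      rfl
    obtain ⟨n, hn, h⟩ := 𝔐.exists_mem_apply_Ω_eq hN (y := y)
      (fun a ha => hyf _ (Or.inr ⟨a, ha, rfl⟩))
      (by ext ξ; exact hyf _ (Or.inl rfl) ξ)
    refine ⟨n, hn, h.trans ?_⟩
    rw [hy, ContinuousLinearMap.comp_apply, ContinuousLinearMap.comp_apply, adjoint_coord_apply]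
    rfl
  choose n hn h using main
  exact ⟨fun i => ⟨n i, hn i⟩, fun i => (h i).symm⟩

section PartialIso

variable {F : Submodule ℂ H} [CompleteSpace F] {k m' : ℕ}
variable (W : ampSubspace F k →ₗᵢ[ℂ] Amp H m') {L : Submodule ℂ (Amp H k)}
  [L.HasOrthogonalProjection]

theorem conj_partialIso_apply (hL : L ≤ ampSubspace F k) {ζ : Amp H k} (hζ : ζ ∈ L) :
    (partialIso W ∘L L.starProjection ∘L ContinuousLinearMap.adjoint (partialIso W))
      (partialIso W ζ) = partialIso W ζ := by
  simp only [ContinuousLinearMap.comp_apply]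
  rw [adjoint_partialIso_apply, Submodule.starProjection_eq_self_iff.2 (hL hζ),
    Submodule.starProjection_eq_self_iff.2 hζ]

theorem isStarProjection_conj_partialIso (hL : L ≤ ampSubspace F k) :
    IsStarProjection
      (partialIso W ∘L L.starProjection ∘L ContinuousLinearMap.adjoint (partialIso W)) := by
  refine ⟨?_, ?_⟩
  · ext1 η
    exact conj_partialIso_apply W hL (L.starProjection_apply_mem _)
  · rw [isSelfAdjoint_iff, ContinuousLinearMap.star_eq_adjoint, ContinuousLinearMap.adjoint_comp,
      ContinuousLinearMap.adjoint_comp, ContinuousLinearMap.adjoint_adjoint,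
      ← ContinuousLinearMap.star_eq_adjoint L.starProjection,
      (isStarProjection_starProjection L).isSelfAdjoint]
    rfl

theorem re_tr_conj_partialIso_mono {S S' : Amp H k →L[ℂ] Amp H k} (h : S ≤ S') :
    (𝔐.tr (partialIso W ∘L S ∘L ContinuousLinearMap.adjoint (partialIso W))).re
      ≤ (𝔐.tr (partialIso W ∘L S' ∘L ContinuousLinearMap.adjoint (partialIso W))).re := by
  refine 𝔐.re_tr_mono ((ContinuousLinearMap.le_def _ _).2 ?_)
  have := ((ContinuousLinearMap.le_def _ _).1 h).conj_adjoint (partialIso W)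
  convert this using 1
  ext1 η
  simp

end PartialIso

end TracialAlgebra

end Rows

end FolnerDim

namespace FolnerDim

/-! ### The rank inequality over `N`. -/

section RankNullity

variable {H : Type*} [NormedAddCommGroup H] [InnerProductSpace ℂ H] [CompleteSpace H]
variable (𝔐 : TracialAlgebra H) {R : StarSubalgebra ℂ (H →L[ℂ] H)}

theorem apply_Ω_mem_hilbertClosure {P : Submodule (↥R)ᵐᵒᵖ (H →L[ℂ] H)} {x : H →L[ℂ] H}
    (hx : x ∈ P) : x 𝔐.Ω ∈ hilbertClosure 𝔐 P :=
  Submodule.le_topologicalClosure _ ⟨x, hx, rfl⟩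

theorem mul_mem_of_right {P : Submodule (↥R)ᵐᵒᵖ (H →L[ℂ] H)} {x a : H →L[ℂ] H}
    (hx : x ∈ P) (ha : a ∈ R) : x * a ∈ P :=
  P.smul_mem (MulOpposite.op ⟨a, ha⟩) hx

theorem hilbertClosure_invariant (hR : R ≤ 𝔐.M.toStarSubalgebra)
    {P : Submodule (↥R)ᵐᵒᵖ (H →L[ℂ] H)} (hP : ∀ x ∈ P, x ∈ 𝔐.M) (a : H →L[ℂ] H) (ha : a ∈ R)
    (ξ : H) (hξ : ξ ∈ hilbertClosure 𝔐 P) : 𝔐.ractL a ξ ∈ hilbertClosure 𝔐 P := by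
  have h : Set.MapsTo (𝔐.ractL a) ((toComplex P).map 𝔐.Λ : Submodule ℂ H)
      (((toComplex P).map 𝔐.Λ : Submodule ℂ H) : Set H) := by
    rintro _ ⟨x, hx, rfl⟩
    refine ⟨x * a, mul_mem_of_right hx ha, ?_⟩
    exact (𝔐.ractL_apply (hR ha) (hP x hx)).symm
  have := h.closure (𝔐.ractL a).continuous
  rw [← Submodule.topologicalClosure_coe] at this
  exact this hξ

theorem bvec_apply {ι : Type*} [Fintype ι] [DecidableEq ι] (l l' : ι) :
    𝔐.bvec l l' = if l' = l then 𝔐.Ω else 0 := by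
  rw [TracialAlgebra.bvec, PiLp.toLp_apply, Pi.single_apply]

theorem Λ_apply (x : H →L[ℂ] H) : 𝔐.Λ x = x 𝔐.Ω := rfl

variable {k : ℕ} {T : Matrix (Fin k) (Fin k) (H →L[ℂ] H)}
  {P S : Submodule (↥R)ᵐᵒᵖ (H →L[ℂ] H)}

theorem kerOn_invariant (hR : R ≤ 𝔐.M.toStarSubalgebra) (hS : ∀ x ∈ S, x ∈ 𝔐.M)
    {a : H →L[ℂ] H} (ha : a ∈ R) {ξ : Amp H k} (hξ : ξ ∈ kerOn 𝔐 T S) :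
    diagL (𝔐.ractL a) ξ ∈ kerOn 𝔐 T S := by
  obtain ⟨s, hs, hTs, rfl⟩ := hξ
  refine ⟨fun i => s i * a, fun i => mul_mem_of_right (hs i) ha, ?_, ?_⟩
  · ext1 i
    have := congrArg (· * a) (congrFun hTs i)
    simpa [Matrix.mulVec, dotProduct, Finset.sum_mul, mul_assoc] using this
  · ext i
    exact 𝔐.ractL_apply (hR ha) (hS _ (hs i))

theorem kerOn_le_ampSubspace (hSP : S ≤ P) :
    (kerOn 𝔐 T S).topologicalClosure ≤ ampSubspace (hilbertClosure 𝔐 P) k := by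
  refine Submodule.topologicalClosure_minimal _ ?_
    (isClosed_ampSubspace _ (Submodule.isClosed_topologicalClosure _) k)
  rintro _ ⟨s, hs, -, rfl⟩ i
  exact apply_Ω_mem_hilbertClosure 𝔐 (hSP (hs i))

theorem kerOn_le_ker :
    (kerOn 𝔐 T S).topologicalClosure ≤ (matL T).ker := by
  refine Submodule.topologicalClosure_minimal _ ?_ (matL T).isClosed_ker
  rintro _ ⟨s, -, hTs, rfl⟩
  rw [LinearMap.mem_ker, ContinuousLinearMap.coe_coe]
  ext i
  rw [matL_apply]
  have := DFunLike.congr_fun (congrFun hTs i) 𝔐.Ω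
  simpa [Matrix.mulVec, dotProduct, Λ_apply] using this

variable {N : VonNeumannAlgebra H} {m : ℕ} {x : Fin m → (H →L[ℂ] H)}
  {p : Matrix (Fin m) (Fin m) N.toStarSubalgebra}

theorem rowAmp_apply_of_coeff (k : ℕ) (x : Fin m → (H →L[ℂ] H)) {ξ : HSum H (Fin k × Fin m)}
    {n : Fin k × Fin m → N.toStarSubalgebra} (h : ∀ l, ξ l = (n l : H →L[ℂ] H) 𝔐.Ω) (i : Fin k) :
    rowAmp k x ξ i = (∑ j, x j * (n (i, j) : H →L[ℂ] H)) 𝔐.Ω := by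
  rw [rowAmp_apply, sum_apply]
  exact Finset.sum_congr rfl fun j _ => by rw [h]; rfl

theorem sum_inner_coeff (hp : p.IsHermitian) (j : Fin m) (n : Fin m → N.toStarSubalgebra) :
    ∑ j', inner ℂ ((p j' j : H →L[ℂ] H) 𝔐.Ω) ((n j' : H →L[ℂ] H) 𝔐.Ω)
      = inner ℂ 𝔐.Ω (((p.mulVec n j : N.toStarSubalgebra) : H →L[ℂ] H) 𝔐.Ω) := by
  have h1 : ((p.mulVec n j : N.toStarSubalgebra) : H →L[ℂ] H)
      = ∑ j', (p j j' : H →L[ℂ] H) * (n j' : H →L[ℂ] H) := by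
    simp [Matrix.mulVec, dotProduct]
  rw [h1, sum_apply, inner_sum]
  refine Finset.sum_congr rfl fun j' _ => ?_
  have h2 : (p j j' : H →L[ℂ] H) = star (p j' j : H →L[ℂ] H) :=
    congrArg Subtype.val (hp.apply j j').symm
  rw [h2, mul_apply_eq_comp, ContinuousLinearMap.star_eq_adjoint,
    ContinuousLinearMap.adjoint_inner_right]

variable {P' S' : Submodule (↥N.toStarSubalgebra)ᵐᵒᵖ (H →L[ℂ] H)}
variable (hN : N.toStarSubalgebra ≤ 𝔐.M.toStarSubalgebra)
include hN

theorem rowAmp_comp_projL2 (hx : ∀ j, x j ∈ 𝔐.M) (k : ℕ) :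
    Intertwines (𝔐.ractSet N.toStarSubalgebra)
      (rowAmp k x ∘L diagL (𝔐.projL2 N.toStarSubalgebra)) := by
  refine (𝔐.intertwines_matL hN fun i l => ?_).comp ?_
  · rw [Matrix.of_apply]
    split_ifs
    · exact hx _
    · exact zero_mem 𝔐.M
  · rintro _ ⟨a, ha, rfl⟩ ξ
    ext i
    exact (𝔐.projL2_ractL hN ha _).symm

/-- If `x` is a row such that `x v = 0` if and only if `p v = 0`, for `v ∈ N^m`, then the kernel
of the amplification of `x` to `L²(N)^(k × m)` has codimension `k ∑ τ (p j j)`. -/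
theorem re_tr_one_sub_starProjection_ker (hx : ∀ j, x j ∈ 𝔐.M) (hp : p.IsHermitian)
    (hpp : IsIdempotentElem p)
    (hxp : ∀ v : Fin m → N.toStarSubalgebra, ∑ j, x j * (v j : H →L[ℂ] H) = 0 ↔ p.mulVec v = 0)
    (k : ℕ) :
    (𝔐.tr (1 - (rowAmp k x ∘L
      diagL (𝔐.projL2 N.toStarSubalgebra)).ker.starProjection)).re
      = k * (∑ j, 𝔐.τ (p j j : H →L[ℂ] H)).re := by
  set e := 𝔐.projL2 N.toStarSubalgebra with he
  set Y := rowAmp k x ∘L diagL e with hY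
  set r := Y.ker.starProjection with hr
  have hri : Intertwines (𝔐.eqvSet N.toStarSubalgebra) r :=
    𝔐.intertwines_starProjection_ker (rowAmp_comp_projL2 𝔐 hN hx k) fun ξ => by
      rw [hY, ContinuousLinearMap.comp_apply, he, 𝔐.diagL_projL2_idem]
      rfl
  have hsum : ∀ n : Fin m → N.toStarSubalgebra, ∑ j, x j * (n j : H →L[ℂ] H) ∈ 𝔐.M := fun n =>
    sum_mem fun j _ => mul_mem (hx j) (hN (n j).2)
  have main : ∀ i j, inner ℂ (𝔐.bvec (i, j)) ((1 - r) (𝔐.bvec (i, j)))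
      = (starRingEnd ℂ) (𝔐.τ (p j j : H →L[ℂ] H)) := fun i j => by
    obtain ⟨n, hn⟩ := 𝔐.exists_coeff hN hri (i, j)
    have hYr : Y (r (𝔐.bvec (i, j))) = 0 := Y.ker.starProjection_apply_mem _
    -- The kernel projection has entries in `N`, so its columns are algebraic relations among the `x
    -- j`, to which `hxp` applies.
    have hpn : p.mulVec (fun j' => n (i, j')) = 0 := by
      rw [← hxp]
      refine 𝔐.eq_zero_of_apply_Ω (hsum _) ?_
      rw [← rowAmp_apply_of_coeff 𝔐 k x hn]
      have h1 : diagL e (r (𝔐.bvec (i, j))) = r (𝔐.bvec (i, j)) := by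
        rw [← hri e (Or.inl rfl), 𝔐.diagL_projL2_bvec]
      rw [hY, ContinuousLinearMap.comp_apply, h1] at hYr
      rw [hYr]
      rfl
    -- the `(i, j)`-th column of the amplification of `p`
    let w : HSum H (Fin k × Fin m) :=
      WithLp.toLp 2 fun l => if l.1 = i then (p l.2 j : H →L[ℂ] H) 𝔐.Ω else 0
    have hw : inner ℂ w (r (𝔐.bvec (i, j))) = 0 := by
      rw [PiLp.inner_apply, Fintype.sum_prod_type, Finset.sum_eq_single i]
      · simp only [w, if_true, hn]
        rw [sum_inner_coeff 𝔐 hp j fun j' => n (i, j'), hpn]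
        simp
      · intro i' _ hi'
        simp [w, hi']
      · simp
    -- The other half of `1 - r = p`: the columns of `1 - p` are killed by `p`, hence by the row
    -- `x`.
    have hu : r (𝔐.bvec (i, j) - w) = 𝔐.bvec (i, j) - w := by
      refine Submodule.starProjection_eq_self_iff.2 ?_
      let c : Fin k × Fin m → N.toStarSubalgebra := fun l =>
        if l.1 = i then (Pi.single j 1 : Fin m → N.toStarSubalgebra) l.2 - p l.2 j else 0
      have hc : ∀ l, (𝔐.bvec (i, j) - w) l = (c l : H →L[ℂ] H) 𝔐.Ω := by
        rintro ⟨i', j'⟩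
        obtain rfl | hi := eq_or_ne i' i
        · obtain rfl | hj := eq_or_ne j' j
          · simp [bvec_apply, w, c]
          · simp [bvec_apply, w, c, hj]
        · simp [bvec_apply, w, c, hi]
      have h1 : diagL e (𝔐.bvec (i, j) - w) = 𝔐.bvec (i, j) - w := by
        ext l
        rw [diagL_apply, hc, 𝔐.projL2_apply_Ω (c l).2]
      rw [LinearMap.mem_ker, ContinuousLinearMap.coe_coe, hY, ContinuousLinearMap.comp_apply, h1]
      ext i'
      rw [rowAmp_apply_of_coeff 𝔐 k x hc]
      have h2 : ∑ j', x j' * (c (i', j') : H →L[ℂ] H) = 0 := by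
        rw [hxp fun j' => c (i', j')]
        obtain rfl | hi := eq_or_ne i' i
        · have h3 : (fun j' => c (i', j'))
              = Pi.single j 1 - p.mulVec (Pi.single j 1) := by
            ext1 j'
            simp [c]
          rw [h3, Matrix.mulVec_sub, Matrix.mulVec_mulVec, hpp.eq, sub_self]
        · have h3 : (fun j' => c (i', j')) = 0 := by
            ext1 j'
            simp [c, hi]
          rw [h3, Matrix.mulVec_zero]
      rw [h2]
      rfl
    have hrs : ∀ ξ η, inner ℂ (r ξ) η = inner ℂ ξ (r η) :=
      Y.ker.inner_starProjection_left_eq_right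
    -- Split the left vector into `bvec - w`, which `r` fixes, and `w`, which is orthogonal to `r
    -- bvec`.
    have h1 : inner ℂ (𝔐.bvec (i, j)) (r (𝔐.bvec (i, j)))
        = inner ℂ (𝔐.bvec (i, j) - w) (𝔐.bvec (i, j)) := by
      rw [← hu, hrs, inner_sub_left, hw, sub_zero]
    have h2 : inner ℂ w (𝔐.bvec (i, j)) = (starRingEnd ℂ) (𝔐.τ (p j j : H →L[ℂ] H)) := by
      rw [← inner_conj_symm, TracialAlgebra.bvec, inner_toLp_single]
      simp [w, TracialAlgebra.τ]
    rw [sub_apply, inner_sub_right, h1, inner_sub_left, h2]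
    simp
  rw [TracialAlgebra.tr, Fintype.sum_prod_type]
  simp only [main]
  rw [Finset.sum_const, Finset.card_univ, Fintype.card_fin, ← map_sum, nsmul_eq_mul,
    ← Complex.ofReal_natCast, Complex.re_ofReal_mul, Complex.conj_re]

/-- The rank theorem: for a finitely generated projective submodule of `S`, presented by `x` and
`p`, the kernel of `T` on `S^k` and the range of `T` have total dimension at least
`k ∑ τ (p j j)`. -/
theorem mul_re_trace_le (hP : ∀ y ∈ P', y ∈ 𝔐.M) (hSP : S' ≤ P') (hT : ∀ i j, T i j ∈ 𝔐.M)
    (hTS : ∀ i j, ∀ s ∈ S', T i j * s ∈ P') (hp : p.IsHermitian) (hpp : IsIdempotentElem p)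
    (hxS : ∀ v : Fin m → N.toStarSubalgebra, ∑ j, x j * (v j : H →L[ℂ] H) ∈ S')
    (hxp : ∀ v : Fin m → N.toStarSubalgebra, ∑ j, x j * (v j : H →L[ℂ] H) = 0 ↔ p.mulVec v = 0)
    {m' : ℕ} {W : ampSubspace (hilbertClosure 𝔐 P') k →ₗᵢ[ℂ] Amp H m'}
    (hW : IsNormalEmbedding 𝔐 N.toStarSubalgebra (ampAct 𝔐) _ W) :
    k * (∑ j, 𝔐.τ (p j j : H →L[ℂ] H)).re ≤
      (𝔐.tr (partialIso W ∘L (kerOn 𝔐 T S').topologicalClosure.starProjection ∘L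
        ContinuousLinearMap.adjoint (partialIso W))).re +
      (𝔐.tr (partialIso W ∘L (matL T).range.topologicalClosure.starProjection ∘L
        ContinuousLinearMap.adjoint (partialIso W))).re := by
  have hxS' : ∀ j, x j ∈ S' := fun j => by
    have h := hxS (Pi.single j 1)
    rwa [Finset.sum_eq_single j (fun j' _ h => by simp [Pi.single_eq_of_ne h]) (by simp),
      Pi.single_eq_same, OneMemClass.coe_one, mul_one] at h
  have hx : ∀ j, x j ∈ 𝔐.M := fun j => hP _ (hSP (hxS' j))
  have hF := hilbertClosure_invariant 𝔐 hN hP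
  set e := 𝔐.projL2 N.toStarSubalgebra with he
  set Y₀ := rowAmp k x ∘L diagL e with hY₀
  set Y₁ := matL T ∘L Y₀ with hY₁
  have hee : ∀ ξ : HSum H (Fin k × Fin m), diagL e (diagL e ξ) = diagL e ξ := fun ξ =>
    𝔐.diagL_projL2_idem ξ
  have hY₀i : Intertwines (𝔐.ractSet N.toStarSubalgebra) Y₀ := rowAmp_comp_projL2 𝔐 hN hx k
  have hY₁i : Intertwines (𝔐.ractSet N.toStarSubalgebra) Y₁ := (𝔐.intertwines_matL hN hT).comp hY₀i
  have hY₀e : ∀ ξ, Y₀ (diagL e ξ) = Y₀ ξ := fun ξ => by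
    simp only [hY₀, ContinuousLinearMap.comp_apply]
    rw [hee]
  have hY₁e : ∀ ξ, Y₁ (diagL e ξ) = Y₁ ξ := fun ξ => by
    rw [hY₁, ContinuousLinearMap.comp_apply, hY₀e]
    rfl
  set r := Y₀.ker.starProjection with hr
  set q := Y₁.ker.starProjection with hq
  have hqi : Intertwines (𝔐.eqvSet N.toStarSubalgebra) q :=
    𝔐.intertwines_starProjection_ker hY₁i hY₁e
  have hY₀b : ∀ a ∈ N, ∀ l, Y₀ (diagL (𝔐.ractL a) (𝔐.bvec l))
      = WithLp.toLp 2 (Pi.single l.1 ((x l.2 * a) 𝔐.Ω)) := by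
    rintro a ha ⟨i, j⟩
    have haM : a ∈ 𝔐.M := hN ha
    rw [hY₀i _ ⟨a, ha, rfl⟩, hY₀, ContinuousLinearMap.comp_apply, 𝔐.diagL_projL2_bvec]
    ext i'
    rw [diagL_apply, rowAmp_apply]
    obtain rfl | hi := eq_or_ne i' i
    · rw [Finset.sum_eq_single j]
      · rw [TracialAlgebra.bvec]
        simp only [Pi.single_eq_same]
        exact 𝔐.ractL_apply haM (hx j)
      · intro j' _ hj
        simp [bvec_apply, hj]
      · simp
    · rw [Finset.sum_eq_zero]
      · simp [Pi.single_eq_of_ne hi]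
      · intro j' _
        simp [bvec_apply, hi]
  have hFc : IsClosed (ampSubspace (hilbertClosure 𝔐 P') k : Set (Amp H k)) :=
    isClosed_ampSubspace _ (Submodule.isClosed_topologicalClosure _) k
  have hY₀F : ∀ ξ, Y₀ ξ ∈ ampSubspace (hilbertClosure 𝔐 P') k := fun ξ => by
    rw [← hY₀e]
    refine 𝔐.diagL_projL2_mem hN
      (C := (ampSubspace (hilbertClosure 𝔐 P') k).comap Y₀.toLinearMap)
      (hFc.preimage Y₀.continuous) (fun a ha l => ?_) ξ
    change Y₀ _ ∈ ampSubspace (hilbertClosure 𝔐 P') k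
    rw [hY₀b a ha]
    intro i
    obtain rfl | hi := eq_or_ne i l.1
    · rw [PiLp.toLp_apply, Pi.single_eq_same]
      exact apply_Ω_mem_hilbertClosure 𝔐 (hSP (mul_mem_of_right (hxS' _) ha))
    · rw [PiLp.toLp_apply, Pi.single_eq_of_ne hi]
      exact Submodule.zero_mem _
  have hY₁F : ∀ ξ, Y₁ ξ ∈ ampSubspace (hilbertClosure 𝔐 P') k := fun ξ => by
    rw [← hY₁e]
    refine 𝔐.diagL_projL2_mem hN
      (C := (ampSubspace (hilbertClosure 𝔐 P') k).comap Y₁.toLinearMap)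
      (hFc.preimage Y₁.continuous) (fun a ha l => ?_) ξ
    change matL T (Y₀ _) ∈ ampSubspace (hilbertClosure 𝔐 P') k
    rw [hY₀b a ha]
    intro i
    rw [matL_apply, Finset.sum_eq_single l.1]
    · rw [PiLp.toLp_apply, Pi.single_eq_same, ← mul_apply_eq_comp]
      exact apply_Ω_mem_hilbertClosure 𝔐 (hTS _ _ _ (mul_mem_of_right (hxS' _) ha))
    · intro i' _ hi
      rw [PiLp.toLp_apply, Pi.single_eq_of_ne hi, map_zero]
    · simp
  -- It suffices to look at translates of basis vectors. There the column of `q` has entries in `N`,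
  -- so `Y₀` sends it to an honest element of `S'^k`, and `T` kills that element because `Ω` is
  -- separating.
  have hY₀E : ∀ ξ, Y₀ (q ξ) ∈ (kerOn 𝔐 T S').topologicalClosure := fun ξ => by
    rw [← hY₀e, ← hqi e (Or.inl rfl)]
    refine 𝔐.diagL_projL2_mem hN
      (C := (kerOn 𝔐 T S').topologicalClosure.comap (Y₀ ∘L q).toLinearMap)
      ((Submodule.isClosed_topologicalClosure _).preimage (Y₀ ∘L q).continuous)
      (fun a ha l => ?_) ξ
    change Y₀ (q _) ∈ (kerOn 𝔐 T S').topologicalClosure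
    rw [hqi _ (Or.inr ⟨a, ha, rfl⟩), hY₀i _ ⟨a, ha, rfl⟩]
    refine Submodule.le_topologicalClosure _
      (kerOn_invariant 𝔐 hN (fun y hy => hP y (hSP hy)) ha ?_)
    obtain ⟨n, hn⟩ := 𝔐.exists_coeff hN hqi l
    have h1 : diagL e (q (𝔐.bvec l)) = q (𝔐.bvec l) := by
      rw [← hqi e (Or.inl rfl), 𝔐.diagL_projL2_bvec]
    have h2 : ∀ i, Y₀ (q (𝔐.bvec l)) i
        = (∑ j, x j * (n (i, j) : H →L[ℂ] H)) 𝔐.Ω := fun i => by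
      rw [hY₀, ContinuousLinearMap.comp_apply, h1, rowAmp_apply_of_coeff 𝔐 k x hn]
    have hker : Y₁ (q (𝔐.bvec l)) = 0 := Y₁.ker.starProjection_apply_mem _
    have hM : ∀ i, ∑ j, x j * (n (i, j) : H →L[ℂ] H) ∈ 𝔐.M := fun i =>
      hP _ (hSP (hxS fun j => n (i, j)))
    refine ⟨fun i => ∑ j, x j * (n (i, j) : H →L[ℂ] H), fun i => hxS fun j => n (i, j), ?_, ?_⟩
    · ext1 i
      change ∑ i', T i i' * ∑ j, x j * (n (i', j) : H →L[ℂ] H) = 0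
      refine 𝔐.eq_zero_of_apply_Ω (sum_mem fun i' _ => mul_mem (hT _ _) (hM i')) ?_
      have h3 : Y₁ (q (𝔐.bvec l)) i = 0 := by rw [hker]; rfl
      rw [hY₁, ContinuousLinearMap.comp_apply, matL_apply] at h3
      simp only [h2] at h3
      rw [sum_apply]
      exact h3
    · ext i
      exact h2 i
  have hWi := intertwines_partialIso 𝔐 hF hW
  have hWY₀ : Intertwines (𝔐.eqvSet N.toStarSubalgebra) (partialIso W ∘L Y₀) :=
    𝔐.intertwines_eqvSet (hWi.comp hY₀i) (fun _ => diagL_partialIso hW _) fun ξ => by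
      simp only [ContinuousLinearMap.comp_apply]
      rw [hY₀e]
  have hWY₁ : Intertwines (𝔐.eqvSet N.toStarSubalgebra) (partialIso W ∘L Y₁) :=
    𝔐.intertwines_eqvSet (hWi.comp hY₁i) (fun _ => diagL_partialIso hW _) fun ξ => by
      rw [ContinuousLinearMap.comp_apply, hY₁e]
      rfl
  have hle : Y₀.ker ≤ Y₁.ker := fun ξ hξ => by
    rw [LinearMap.mem_ker, ContinuousLinearMap.coe_coe] at hξ ⊢
    rw [hY₁, ContinuousLinearMap.comp_apply, hξ, map_zero]
  have hqP := isStarProjection_starProjection Y₁.ker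
  have hrP := isStarProjection_starProjection Y₀.ker
  have hrq : r * q = r := Submodule.starProjection_comp_starProjection_of_le hle
  have hqr : q * r = r := by
    have := congrArg star hrq
    rwa [star_mul, hqP.isSelfAdjoint, hrP.isSelfAdjoint] at this
  have hqrP : IsStarProjection (q - r) := by
    refine ⟨?_, hqP.isSelfAdjoint.sub hrP.isSelfAdjoint⟩
    rw [IsIdempotentElem, sub_mul, mul_sub, mul_sub, hrq, hqr, hqP.isIdempotentElem,
      hrP.isIdempotentElem, sub_self, sub_zero]
  -- `Y₀` is injective on the range of `q - r`, that is on `ker Y₁ ⊖ ker Y₀`, and maps it into the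
  -- closed kernel of `T` on `S'^k`.
  have c1 := 𝔐.re_tr_le_of_injective hN (hWY₀.comp hqi) hqrP
    (TracialAlgebra.isStarProjection_conj_partialIso W (kerOn_le_ampSubspace 𝔐 (T := T) hSP))
    (fun ξ hξ => by
      have h1 : Y₀ (q ξ) = 0 := partialIso_eq_zero W (hY₀F _) hξ
      have h2 : r (q ξ) = q ξ := Submodule.starProjection_eq_self_iff.2 h1
      have h3 : r (q ξ) = r ξ := DFunLike.congr_fun hrq ξ
      rw [sub_apply, ← h2, h3, sub_self])
    (fun ξ => TracialAlgebra.conj_partialIso_apply W (kerOn_le_ampSubspace 𝔐 (T := T) hSP)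
      (hY₀E ξ))
  have hLF : Y₁.range.topologicalClosure ≤ ampSubspace (hilbertClosure 𝔐 P') k := by
    refine Submodule.topologicalClosure_minimal _ ?_ hFc
    rintro _ ⟨ξ, rfl⟩
    exact hY₁F ξ
  -- `Y₁` is injective on the complement of its kernel. Its closed range lies in `F^k`, so the
  -- compressed projection is still a projection; the closed range of `T` need not lie there and
  -- enters only by monotonicity.
  have c2 := 𝔐.re_tr_le_of_injective hN hWY₁ hqP.one_sub
    (TracialAlgebra.isStarProjection_conj_partialIso W hLF)
    (fun ξ hξ => by
      have h1 : Y₁ ξ = 0 := partialIso_eq_zero W (hY₁F _) hξ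
      have h2 : q ξ = ξ := Submodule.starProjection_eq_self_iff.2 h1
      change ξ - q ξ = 0
      rw [h2, sub_self])
    (fun ξ => TracialAlgebra.conj_partialIso_apply W hLF
      (Submodule.le_topologicalClosure _ ⟨ξ, rfl⟩))
  have hLR : Y₁.range.topologicalClosure ≤ (matL T).range.topologicalClosure := by
    refine Submodule.topologicalClosure_mono ?_
    rintro _ ⟨ξ, rfl⟩
    exact ⟨Y₀ ξ, rfl⟩
  have c3 := 𝔐.re_tr_conj_partialIso_mono W (Submodule.starProjection_le_starProjection_iff.2 hLR)
  have c4 := re_tr_one_sub_starProjection_ker 𝔐 hN hx hp hpp hxp k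
  have c5 : (𝔐.tr (1 - r)).re = (𝔐.tr (q - r)).re + (𝔐.tr (1 - q)).re := by
    rw [← Complex.add_re, ← 𝔐.tr_add]
    congr 2
    abel
  rw [← c4]
  change (𝔐.tr (1 - r)).re ≤ _
  rw [c5]
  exact add_le_add c1 (c2.trans c3)

end RankNullity

end FolnerDim

namespace FolnerDim

/-! ### Dimensions over `M`, the two bounds, and the limit. -/

section Limit

variable {H : Type*} [NormedAddCommGroup H] [InnerProductSpace ℂ H] [CompleteSpace H]
variable (𝔐 : TracialAlgebra H)

theorem L2_self (ξ : H) : ξ ∈ L2 𝔐 𝔐.M.toStarSubalgebra :=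
  𝔐.dense_induction (p := fun ξ => ξ ∈ L2 𝔐 𝔐.M.toStarSubalgebra)
    (Submodule.isClosed_topologicalClosure _) (fun _ ha => 𝔐.apply_Ω_mem_L2 ha) ξ

theorem diagL_projL2_self {ι : Type*} [Fintype ι] (ξ : HSum H ι) :
    diagL (𝔐.projL2 𝔐.M.toStarSubalgebra) ξ = ξ := by
  ext i
  exact 𝔐.projL2_of_mem (L2_self 𝔐 _)

variable {k : ℕ} {T : Matrix (Fin k) (Fin k) (H →L[ℂ] H)}

/-- As `L²(M) = H`, the inclusion is a normal embedding, so the trace is not the default value. For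
the chosen `V`, the trace property exchanges `V V*` with `V* V = P_F`. -/
theorem normalDim_eq_tr (F : Submodule ℂ (Amp H k)) [CompleteSpace F]
    (hF : ∀ a ∈ 𝔐.M.toStarSubalgebra, ∀ ξ ∈ F, diagL (𝔐.ractL a) ξ ∈ F) :
    normalDim 𝔐 𝔐.M.toStarSubalgebra (ampAct 𝔐) F = (𝔐.tr F.starProjection).re := by
  obtain ⟨m, V, hV, h⟩ := exists_normalTrace_eq 𝔐 (R := 𝔐.M.toStarSubalgebra)
    (act := ampAct 𝔐) (F := F) ⟨k, F.subtypeₗᵢ, fun _ _ => L2_self 𝔐 _, fun _ _ _ _ h => h⟩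
  have hVi : Intertwines (𝔐.eqvSet 𝔐.M.toStarSubalgebra) (partialIso V) := by
    refine 𝔐.intertwines_eqvSet ?_ (fun _ => diagL_projL2_self 𝔐 _)
      fun _ => by rw [diagL_projL2_self]
    rintro _ ⟨a, ha, rfl⟩ ξ
    exact partialIso_act hV (A := fun a => diagL (𝔐.ractL a)) (fun _ _ => rfl)
      (fun a => by rw [star_diagL, 𝔐.star_ractL]) hF ha ξ
  rw [normalDim_eq, h]
  congr 1
  change 𝔐.tr (partialIso V ∘L ContinuousLinearMap.adjoint (partialIso V)) = _
  rw [𝔐.tr_comp_comm le_rfl (hVi.adjoint fun f hf => 𝔐.star_mem_eqvSet hf) hVi |>.symm]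
  congr 1
  ext1 ξ
  exact adjoint_partialIso_apply V ξ

theorem matL_diagL (hT : ∀ i j, T i j ∈ 𝔐.M) {f : H →L[ℂ] H} (hf : f ∈ 𝔐.M.commutant)
    (ξ : Amp H k) : matL T (diagL f ξ) = diagL f (matL T ξ) := by
  ext i
  rw [matL_apply, diagL_apply, matL_apply, map_sum]
  refine Finset.sum_congr rfl fun j _ => ?_
  exact DFunLike.congr_fun (VonNeumannAlgebra.mem_commutant_iff.1 hf _ (hT i j)) (ξ j)

theorem ker_invariant (hT : ∀ i j, T i j ∈ 𝔐.M) : ∀ f ∈ 𝔐.M.commutant,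
    ∀ ξ ∈ (matL T).ker, diagL f ξ ∈ (matL T).ker := fun f hf ξ hξ => by
  rw [LinearMap.mem_ker, ContinuousLinearMap.coe_coe] at hξ ⊢
  rw [matL_diagL 𝔐 hT hf, hξ, map_zero]

theorem range_closure_invariant (hT : ∀ i j, T i j ∈ 𝔐.M) : ∀ f ∈ 𝔐.M.commutant,
    ∀ ξ ∈ (matL T).range.topologicalClosure,
      diagL f ξ ∈ (matL T).range.topologicalClosure := fun f hf ξ hξ => by
  have h : Set.MapsTo (diagL f) ((matL T).range : Set (Amp H k)) ((matL T).range) := by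
    rintro _ ⟨η, rfl⟩
    exact ⟨diagL f η, matL_diagL 𝔐 hT hf η⟩
  have := h.closure (diagL f : Amp H k →L[ℂ] Amp H k).continuous
  rw [← Submodule.topologicalClosure_coe] at this
  exact this hξ

/-- The adjoint of `T` is injective on the closed range of `T` and maps into the complement of `ker
T`. -/
theorem re_tr_range_le (hT : ∀ i j, T i j ∈ 𝔐.M) :
    (𝔐.tr (matL T).range.topologicalClosure.starProjection).re
      ≤ k - (𝔐.tr (matL T).ker.starProjection).re := by
  have hTi : Intertwines (𝔐.eqvSet 𝔐.M.toStarSubalgebra) (matL T) :=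
    𝔐.intertwines_eqvSet (𝔐.intertwines_matL le_rfl hT) (fun _ => diagL_projL2_self 𝔐 _)
      fun _ => by rw [diagL_projL2_self]
  have hperp : ∀ ξ, ContinuousLinearMap.adjoint (matL T) ξ ∈ (matL T).kerᗮ := fun ξ η hη => by
    rw [LinearMap.mem_ker, ContinuousLinearMap.coe_coe] at hη
    rw [ContinuousLinearMap.adjoint_inner_right, hη, inner_zero_left]
  have h := 𝔐.re_tr_le_of_injective le_rfl (hTi.adjoint fun f hf => 𝔐.star_mem_eqvSet hf)
    (isStarProjection_starProjection (matL T).range.topologicalClosure)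
    (isStarProjection_starProjection (matL T).ker).one_sub
    (fun ξ hξ => by
      rw [Submodule.starProjection_apply_eq_zero_iff, Submodule.orthogonal_closure]
      rintro _ ⟨η, rfl⟩
      rw [ContinuousLinearMap.coe_coe, ← ContinuousLinearMap.adjoint_inner_right, hξ,
        inner_zero_right])
    (fun ξ => by
      rw [sub_apply, ((matL T).ker.starProjection_apply_eq_zero_iff).2 (hperp ξ), sub_zero]
      rfl)
  have h1 : 𝔐.tr (1 : Amp H k →L[ℂ] Amp H k) = k := by
    simp only [TracialAlgebra.tr, one_apply_eq_self]
    simp [TracialAlgebra.bvec, inner_self_eq_norm_sq_to_K, 𝔐.norm_Ω]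
  rw [𝔐.tr_sub, h1, Complex.sub_re, Complex.natCast_re] at h
  exact h

section Entries

variable {L : Submodule ℂ (Amp H k)} [L.HasOrthogonalProjection]

/-- The `i`-th diagonal entry of the orthogonal projection onto `L`. -/
def diagEntry (L : Submodule ℂ (Amp H k)) [L.HasOrthogonalProjection] (i : Fin k) : H →L[ℂ] H :=
  coord i ∘L L.starProjection ∘L ContinuousLinearMap.adjoint (coord i)

theorem norm_diagEntry_le (i : Fin k) : ‖diagEntry L i‖ ≤ 1 := by
  refine ContinuousLinearMap.opNorm_le_bound _ zero_le_one fun ξ => ?_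
  rw [one_mul, diagEntry, ContinuousLinearMap.comp_apply, ContinuousLinearMap.comp_apply,
    adjoint_coord_apply, coord_apply]
  refine (PiLp.norm_apply_le _ i).trans ((L.norm_starProjection_apply_le _).trans ?_)
  exact (PiLp.norm_single 2 (fun _ : Fin k => H) i ξ).le

theorem sum_τ_diagEntry : ∑ i, 𝔐.τ (diagEntry L i) = 𝔐.tr L.starProjection := by
  refine Finset.sum_congr rfl fun i _ => ?_
  rw [TracialAlgebra.τ, diagEntry, ContinuousLinearMap.comp_apply, ContinuousLinearMap.comp_apply,
    adjoint_coord_apply, TracialAlgebra.bvec, inner_toLp_single]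
  rfl

variable (hL : ∀ f ∈ 𝔐.M.commutant, ∀ ξ ∈ L, diagL f ξ ∈ L)
include hL

theorem diagEntry_mem (i : Fin k) : diagEntry L i ∈ 𝔐.M := by
  rw [← 𝔐.M.commutant_commutant, VonNeumannAlgebra.mem_commutant_iff]
  intro f hf
  have h := Intertwines.starProjection (s := (𝔐.M.commutant : Set (H →L[ℂ] H)))
    (fun f hf => star_mem hf) L hL
  ext ξ
  have h1 : ContinuousLinearMap.adjoint (coord i : Amp H k →L[ℂ] H) (f ξ)
      = diagL f (ContinuousLinearMap.adjoint (coord i : Amp H k →L[ℂ] H) ξ) := by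
    ext j
    rw [diagL_apply, adjoint_coord_apply, adjoint_coord_apply, PiLp.toLp_apply,
      PiLp.toLp_apply]
    obtain rfl | hj := eq_or_ne j i
    · rw [Pi.single_eq_same, Pi.single_eq_same]
    · rw [Pi.single_eq_of_ne hj, Pi.single_eq_of_ne hj, map_zero]
  rw [mul_apply_eq_comp, mul_apply_eq_comp, diagEntry]
  simp only [ContinuousLinearMap.comp_apply]
  rw [h1, h f hf]
  rfl

end Entries

variable {R : StarSubalgebra ℂ (H →L[ℂ] H)} {P : Submodule (↥R)ᵐᵒᵖ (H →L[ℂ] H)}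

theorem enorm_phi_sub_le {x : H →L[ℂ] H} (hx : x ∈ 𝔐.M) (hx1 : ‖x‖ ≤ 1) :
    ‖phi 𝔐 P x - 𝔐.τ x‖ₑ ≤ traceDefect 𝔐 P :=
  le_iSup_of_le x (le_iSup_of_le hx (le_iSup_of_le hx1 le_rfl))

theorem tendsto_phi {P : ℕ → Submodule (↥R)ᵐᵒᵖ (H →L[ℂ] H)}
    (h : Tendsto (fun n => traceDefect 𝔐 (P n)) atTop (𝓝 0)) {x : H →L[ℂ] H} (hx : x ∈ 𝔐.M)
    (hx1 : ‖x‖ ≤ 1) : Tendsto (fun n => phi 𝔐 (P n) x) atTop (𝓝 (𝔐.τ x)) := by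
  rw [tendsto_iff_edist_tendsto_0]
  refine tendsto_of_tendsto_of_tendsto_of_le_of_le tendsto_const_nhds h (fun _ => zero_le) ?_
  intro n
  simp only [edist_eq_enorm_sub]
  exact enorm_phi_sub_le 𝔐 hx hx1

/-- `τ 1 = 1`, so `φ_P 1 = 0` would force a defect of at least `1`. Non-vanishing excludes the
default values hidden in `phi`. -/
theorem phi_one_ne_zero (h : traceDefect 𝔐 P < 1) : phi 𝔐 P 1 ≠ 0 := fun h0 => by
  have h1 : ‖phi 𝔐 P 1 - 𝔐.τ 1‖ₑ < 1 := (enorm_phi_sub_le 𝔐 (one_mem 𝔐.M)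
    ContinuousLinearMap.norm_id_le).trans_lt h
  have h2 : 𝔐.τ 1 = 1 := by
    simp [TracialAlgebra.τ, inner_self_eq_norm_sq_to_K, 𝔐.norm_Ω]
  rw [h0, h2] at h1
  simp at h1

variable {S : Submodule (↥R)ᵐᵒᵖ (H →L[ℂ] H)}

theorem mul_toReal_vnDim_le {c : ℝ} (hc : 0 ≤ c)
    (h : ∀ (Q : Submodule (↥R)ᵐᵒᵖ S) (m : ℕ) (p : Matrix (Fin m) (Fin m) R),
      p.IsHermitian → IsIdempotentElem p → (Q ≃ₗ[(↥R)ᵐᵒᵖ] matrixModule p) →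
        k * (∑ j, 𝔐.τ (p j j : H →L[ℂ] H)).re ≤ c) :
    k * (vnDim 𝔐 R S).toReal ≤ c := by
  obtain rfl | hk := Nat.eq_zero_or_pos k
  · simpa using hc
  have hk' : (0 : ℝ) < k := by exact_mod_cast hk
  rw [← le_div_iff₀' hk']
  refine ENNReal.toReal_le_of_le_ofReal (by positivity) ?_
  refine iSup_le fun Q => iSup_le fun m => iSup_le fun p => iSup_le fun hp => iSup_le fun ⟨φ⟩ => ?_
  refine ENNReal.ofReal_le_ofReal ?_
  rw [le_div_iff₀' hk']
  exact h Q m p hp.1 hp.2 φ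

variable {N : VonNeumannAlgebra H} {P S : Submodule (↥N.toStarSubalgebra)ᵐᵒᵖ (H →L[ℂ] H)}

theorem relDim_bounds (hN : N.toStarSubalgebra ≤ 𝔐.M.toStarSubalgebra)
    (hP : ∀ y ∈ P, y ∈ 𝔐.M) (hSP : S ≤ P) (hT : ∀ i j, T i j ∈ 𝔐.M)
    (hTS : ∀ i j, ∀ s ∈ S, T i j * s ∈ P) (hdef : traceDefect 𝔐 P < 1) :
    k * ((vnDim 𝔐 N.toStarSubalgebra S).toReal / (vnDim 𝔐 N.toStarSubalgebra P).toReal)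
        - (∑ i, phi 𝔐 P (diagEntry (matL T).range.topologicalClosure i)).re
      ≤ relDim 𝔐 P (kerOn 𝔐 T S) ∧
    relDim 𝔐 P (kerOn 𝔐 T S) ≤ (∑ i, phi 𝔐 P (diagEntry (matL T).ker i)).re := by
  have hphi := phi_one_ne_zero 𝔐 hdef
  set d := (vnDim 𝔐 N.toStarSubalgebra P).toReal with hd
  -- Were `d` zero, or were there no normal embedding, `phi` would vanish at `1`. So the small
  -- defect supplies both a genuine denominator and a genuine trace.
  have hd0 : d ≠ 0 := fun h => hphi (by rw [phi, ← hd, h, Complex.ofReal_zero, div_zero])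
  have hdpos : 0 < d := lt_of_le_of_ne ENNReal.toReal_nonneg hd0.symm
  have hex : ∃ m : ℕ, ∃ V : hilbertClosure 𝔐 P →ₗᵢ[ℂ] Amp H m,
      IsNormalEmbedding 𝔐 N.toStarSubalgebra 𝔐.ract (hilbertClosure 𝔐 P) V := by
    by_contra h
    exact hphi (by rw [phi, normalTrace, dif_neg h, zero_div])
  obtain ⟨m, V, hV, htV⟩ := exists_normalTrace_eq 𝔐 hex
  obtain ⟨m', W, hW, htW⟩ := exists_normalTrace_eq 𝔐
    (act := ampAct 𝔐) (F := ampSubspace (hilbertClosure 𝔐 P) k)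
    ⟨k * m, ampIso V k, isNormalEmbedding_ampIso 𝔐 hV k⟩
  have hF := hilbertClosure_invariant 𝔐 hN hP
  -- The trace on `F^k` splits into traces of diagonal entries on `F`, which are values of `phi` up
  -- to the factor `d`.
  have key : ∀ (L : Submodule ℂ (Amp H k)) [L.HasOrthogonalProjection],
      (∀ f ∈ 𝔐.M.commutant, ∀ ξ ∈ L, diagL f ξ ∈ L) →
      (𝔐.tr (partialIso W ∘L L.starProjection ∘L
        ContinuousLinearMap.adjoint (partialIso W))).re
        = d * (∑ i, phi 𝔐 P (diagEntry L i)).re := fun L _ hL => by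
    have hLi : Intertwines (𝔐.ractSet N.toStarSubalgebra) L.starProjection := by
      rintro _ ⟨a, ha, rfl⟩ ξ
      exact Intertwines.starProjection (s := (𝔐.M.commutant : Set (H →L[ℂ] H)))
        (fun f hf => star_mem hf) L hL _ (𝔐.ractL_mem_commutant le_rfl (hN ha)) ξ
    rw [tr_partialIso_amp 𝔐 hN hF hV hW hLi, ← Complex.re_ofReal_mul, Finset.mul_sum]
    congr 1
    refine Finset.sum_congr rfl fun i _ => ?_
    rw [phi, htV, ← hd, mul_div_cancel₀ _ (Complex.ofReal_ne_zero.2 hd0)]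
    rfl
  have hrel : relDim 𝔐 P (kerOn 𝔐 T S)
      = (𝔐.tr (partialIso W ∘L (kerOn 𝔐 T S).topologicalClosure.starProjection ∘L
        ContinuousLinearMap.adjoint (partialIso W))).re / d := by
    rw [relDim, htW]
  have hnonneg : ∀ (L : Submodule ℂ (Amp H k)) [L.HasOrthogonalProjection],
      0 ≤ (𝔐.tr (partialIso W ∘L L.starProjection ∘L
        ContinuousLinearMap.adjoint (partialIso W))).re := fun L _ => by
    have h := 𝔐.re_tr_conj_partialIso_mono W (isStarProjection_starProjection L).nonneg
    refine le_trans (le_of_eq ?_) h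
    simp [TracialAlgebra.tr]
  rw [hrel]
  constructor
  · have h := mul_toReal_vnDim_le (k := k) (S := S) 𝔐
      (add_nonneg (hnonneg (kerOn 𝔐 T S).topologicalClosure)
        (hnonneg (matL T).range.topologicalClosure)) fun Q m p hp hpp φ => by
      obtain ⟨x, hxS, hxp⟩ := exists_row φ
      exact mul_re_trace_le 𝔐 hN hP hSP hT hTS hp hpp hxS hxp hW
    rw [key _ (range_closure_invariant 𝔐 hT)] at h
    rw [sub_le_iff_le_add, mul_div_assoc', div_le_iff₀ hdpos, add_mul, div_mul_cancel₀ _ hd0]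
    linarith
  · rw [div_le_iff₀' hdpos, ← key _ (ker_invariant 𝔐 hT)]
    exact 𝔐.re_tr_conj_partialIso_mono W
      (Submodule.starProjection_le_starProjection_iff.2 (kerOn_le_ker 𝔐))

theorem tendsto_relDim (hN : N.toStarSubalgebra ≤ 𝔐.M.toStarSubalgebra)
    {P S : ℕ → Submodule (↥N.toStarSubalgebra)ᵐᵒᵖ (H →L[ℂ] H)}
    (hP : ∀ n, ∀ y ∈ P n, y ∈ 𝔐.M) (hSP : ∀ n, S n ≤ P n) (hT : ∀ i j, T i j ∈ 𝔐.M)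
    (hTS : ∀ n, ∀ i j, ∀ s ∈ S n, T i j * s ∈ P n)
    (hratio : Tendsto (fun n => (vnDim 𝔐 N.toStarSubalgebra (S n)).toReal /
      (vnDim 𝔐 N.toStarSubalgebra (P n)).toReal) atTop (𝓝 1))
    (htrace : Tendsto (fun n => traceDefect 𝔐 (P n)) atTop (𝓝 0)) :
    Tendsto (fun n => relDim 𝔐 (P n) (kerOn 𝔐 T (S n))) atTop
      (𝓝 (normalDim 𝔐 𝔐.M.toStarSubalgebra (ampAct 𝔐) (matL T).ker)) := by
  have hev : ∀ᶠ n in atTop, traceDefect 𝔐 (P n) < 1 := htrace.eventually_lt_const zero_lt_one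
  have hlim : ∀ (L : Submodule ℂ (Amp H k)) [L.HasOrthogonalProjection],
      (∀ f ∈ 𝔐.M.commutant, ∀ ξ ∈ L, diagL f ξ ∈ L) →
      Tendsto (fun n => (∑ i, phi 𝔐 (P n) (diagEntry L i)).re) atTop
        (𝓝 (𝔐.tr L.starProjection).re) := fun L _ hL => by
    rw [← sum_τ_diagEntry]
    exact (Complex.continuous_re.tendsto _).comp (tendsto_finsetSum _ fun i _ =>
      tendsto_phi 𝔐 htrace (diagEntry_mem 𝔐 hL i) (norm_diagEntry_le i))
  have hupper := hlim _ (ker_invariant 𝔐 hT)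
  have hlower := (hratio.const_mul (k : ℝ)).sub (hlim _ (range_closure_invariant 𝔐 hT))
  have hle := hev.mono fun n hn => relDim_bounds 𝔐 hN (hP n) (hSP n) hT (hTS n) hn
  -- Only one half of the rank-nullity equality for `T` over `M` is proved directly; the other half
  -- follows by comparing the limits of the two bounds.
  have h1 := le_of_tendsto_of_tendsto hlower hupper (hle.mono fun n h => h.1.trans h.2)
  have h2 := re_tr_range_le 𝔐 hT
  have heq : (k : ℝ) * 1 - (𝔐.tr (matL T).range.topologicalClosure.starProjection).re
      = (𝔐.tr (matL T).ker.starProjection).re := le_antisymm h1 (by linarith)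
  rw [heq] at hlower
  rw [normalDim_eq_tr 𝔐 _ fun a ha =>
    ker_invariant 𝔐 hT _ (𝔐.ractL_mem_commutant le_rfl ha)]
  exact tendsto_of_tendsto_of_tendsto_of_le_of_le' hlower hupper (hle.mono fun _ h => h.1)
    (hle.mono fun _ h => h.2)

end Limit

end FolnerDim

end

theorem proposition4p1 {H : Type*} [NormedAddCommGroup H] [InnerProductSpace ℂ H]
    [CompleteSpace H] (𝔐 : FolnerDim.TracialAlgebra H) (N : VonNeumannAlgebra H)
    (A : StarSubalgebra ℂ (H →L[ℂ] H))
    (hNA : N.toStarSubalgebra ≤ A) (hAM : A ≤ 𝔐.M.toStarSubalgebra)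
    (hdense : FolnerDim.IsStronglyDense A 𝔐.M)
    (hA : FolnerDim.StrongFolner 𝔐 N.toStarSubalgebra A)
    (k : ℕ) (T : Matrix (Fin k) (Fin k) A)
    (P S : ℕ → Submodule (↥N.toStarSubalgebra)ᵐᵒᵖ (H →L[ℂ] H))
    (hPS : FolnerDim.IsStrongFolnerSeq 𝔐 A
      (Set.range fun ij : Fin k × Fin k => (T ij.1 ij.2 : H →L[ℂ] H)) P S) :
    Filter.Tendsto
      (fun n => FolnerDim.relDim 𝔐 (P n)
        (FolnerDim.kerOn 𝔐 (T.map fun t => (t : H →L[ℂ] H)) (S n)))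
      Filter.atTop
      (nhds (FolnerDim.normalDim 𝔐 𝔐.M.toStarSubalgebra (FolnerDim.ampAct 𝔐)
        (FolnerDim.matOp (T.map fun t => (t : H →L[ℂ] H))).toLinearMap.ker)) :=
  -- `matOp` and `matL` agree by definition for matrices indexed by `Fin k`, so the kernels match
  -- without rewriting.
  FolnerDim.tendsto_relDim 𝔐 (hNA.trans hAM)
    (fun n y hy => hAM ((hPS.admissible n).subset y hy)) hPS.le
    (fun i j => hAM (T i j).2) (fun n i j => hPS.maps n _ ⟨(i, j), rfl⟩) hPS.ratio hPS.trace
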